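/- Let $I_2(x)=\frac{1}{4\pi|x|}$ on $\mathbb{R}^3$, let $\epsilon\in\{1,-1\}$, and let $f$ be a real function such that, for some $\beta>0$, $$\lim_{t\to0+}\frac{f(t)}{t^{\beta}}=0 .$$ Let $Q:\mathbb{R}^3\to(0,\infty)$ be a positive radially symmetric solution of $$-\Delta Q+Q=\epsilon\,(I_2*Q^2)\,Q+f(Q)\,Q\quad\text{in }\mathbb{R}^3,\qquad Q(x)\to0\ \text{ as }|x|\to\infty,$$ where $(I_2*Q^2)(x)=\int_{\mathbb{R}^3}\frac{Q(y)^2}{4\pi|x-y|}\,dy$. "Solution" is meant in the sense of distributions, which includes classical and weak $H^1$ solutions: the integral defining $I_2*Q^2$ converges almost everywhere, the functions $Q$, $(I_2*Q^2)Q$ and $f(Q)Q$ are locally integrable on $\mathbb{R}^3$, and $$\int_{\mathbb{R}^3}Q\,(-\Delta\varphi+\varphi)\,dx=\int_{\mathbb{R}^3}\big(\epsilon(I_2*Q^2)Q+f(Q)Q\big)\varphi\,dx\quad\text{for all }\varphi\in C_c^\infty(\mathbb{R}^3);$$ as usual, $Q$ denotes the representative that is continuous on $\mathbb{R}^3\setminus\{0\}$.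 Then $Q\in L^2(\mathbb{R}^3)$ and, with $$\alpha=\frac{1}{4\pi}\int_{\mathbb{R}^3}Q^2\,dx,$$ the limit $$\lim_{|x|\to\infty}Q(x)\,|x|^{1-\epsilon\alpha/2}\,e^{|x|}$$ exists and lies in $(0,\infty)$. In particular (take $\epsilon=1$, $f(t)=-C_St$), this applies to positive radially symmetric solutions $Q\in H^1(\mathbb{R}^3)$ of $-\Delta Q+Q-(I_2*Q^2)Q+C_SQ^2=0$ in $\mathbb{R}^3$ with $Q\to0$ at infinity. -/

import Mathlib

open Real Filter Topology MeasureTheory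
open scoped ContDiff Laplacian

noncomputable section

/-- Euclidean three-space. -/
abbrev E3 : Type := EuclideanSpace ℝ (Fin 3)

/-- The Newtonian kernel `I₂(x) = 1 / (4π|x|)` of `ℝ³`. -/
def newtonKernel (x : E3) : ℝ := 1 / (4 * π * ‖x‖)

/-- The potential `(I₂ ∗ Q²)(x) = ∫ Q(y)² / (4π|x - y|) dy`. -/
def newtonPotential (Q : E3 → ℝ) (x : E3) : ℝ := ∫ y, newtonKernel (x - y) * Q y ^ 2

/-- `Q` is radially symmetric: its value at `x` depends only on `|x|`. -/
def IsRadial (Q : E3 → ℝ) : Prop := ∀ x y : E3, ‖x‖ = ‖y‖ → Q x = Q y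

/-- `Q` solves `-ΔQ + Q = ε (I₂ ∗ Q²) Q + f(Q) Q` in the sense of distributions on `ℝ³`:
the convolution `I₂ ∗ Q²` converges almost everywhere, all the terms are locally integrable,
and the equation holds against every smooth compactly supported test function.
Classical solutions and weak `H¹` solutions are of this kind. -/
structure IsSolution (ε : ℝ) (f : ℝ → ℝ) (Q : E3 → ℝ) : Prop where
  locallyIntegrable : LocallyIntegrable Q
  convolution_converges : ∀ᵐ x : E3, Integrable fun y => newtonKernel (x - y) * Q y ^ 2
  nonlocal_locallyIntegrable : LocallyIntegrable fun x => newtonPotential Q x * Q x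
  local_locallyIntegrable : LocallyIntegrable fun x => f (Q x) * Q x
  equation : ∀ φ : E3 → ℝ, ContDiff ℝ ∞ φ → HasCompactSupport φ →
    ∫ x, Q x * (-(Δ φ) x + φ x) =
      ∫ x, (ε * newtonPotential Q x * Q x + f (Q x) * Q x) * φ x

/-- The constant `α = (1/4π) ∫ Q²`. -/
def massConstant (Q : E3 → ℝ) : ℝ := 1 / (4 * π) * ∫ x, Q x ^ 2

end

/-!
The proof reduces the problem to one ordinary differential equation. Write `Q(x) = q(|x|)` and
`u(r) = r q(r)`.

*The potential.* By Newton's shell theorem (`lintegral_newtonKernel`, an integration in cylindrical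
and then polar coordinates), `(I₂ ∗ Q²)(x) = W(|x|)` with `W(r) = ∫₀^∞ s² q(s)² / max(r, s) ds`
(`shellPotential`). Convergence at one point `x ≠ 0` therefore forces `W → 0` at infinity, and once
the mass `α = ∫₀^∞ s² q(s)² ds` is finite, `|W - α / r|` is at most the mass beyond radius `r`
divided by `r`.

*The equation.* Testing the distributional equation with `η(|x|) / |x|`, whose Laplacian is
`η''(|x|) / |x|`, shows that `u'' = g u` weakly on `(0, ∞)` with `g = 1 - ε W - f(q)`. Since `f` need
not be continuous, `g u` is only locally integrable; the lemma of du Bois-Reymond gives that `u` is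
differentiable and `u'` is an indefinite integral of `g u`, i.e. `u` is a Carathéodory solution
(`IsSolution.exists_isCaratheodorySol`). All further information comes from the Wronskian identity
`(u' v - u v')' = (g - g₁) u v` for solutions of `u'' = g u` and `v'' = g₁ v`.

*Decay.* As `g → 1` and `u / r = q → 0`, the positive function `u` is eventually convex and hence
nonincreasing; comparison with `exp (-r/2)` gives `u = O(exp (-r/2))`. So `Q ∈ L²`, and both
`W - α / r` and `f(q) = O(q ^ β)` are `O(r⁻²)`.

*Asymptotics.* With `κ = ε α / 2` this says `g = 1 - 2κ / r + O(r⁻²)`, and `w = r ^ κ exp (-r)` solves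
an equation with a coefficient of the same form. The Wronskian of `u` and `w` vanishes at infinity,
which makes it `O(r⁻² u w)`; so `log (u / w)` has an integrable derivative and `u / w` converges to
a positive limit.
-/

/-! ### Second-order linear equations with a merely integrable coefficient -/

/-- Integration by parts for two indefinite integrals `p = p a + ∫ k`, `φ = φ a + ∫ h` of
integrable functions. -/
theorem mul_sub_mul_eq_integral_of_primitives {p k φ h : ℝ → ℝ} {a b : ℝ} (hab : a ≤ b)
    (hk : IntervalIntegrable k volume a b) (hh : IntervalIntegrable h volume a b)
    (hp : ∀ x ∈ Set.Icc a b, p x - p a = ∫ t in a..x, k t)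
    (hφ : ∀ x ∈ Set.Icc a b, φ x - φ a = ∫ t in a..x, h t) :
    p b * φ b - p a * φ a = ∫ x in a..b, (k x * φ x + p x * h x) := by
  have hconst : ∀ c : ℝ, AbsolutelyContinuousOnInterval (fun _ : ℝ => c) a b := fun c =>
    (LipschitzWith.const c).lipschitzOnWith.absolutelyContinuousOnInterval
  have key : ∀ {q m : ℝ → ℝ}, IntervalIntegrable m volume a b →
      AbsolutelyContinuousOnInterval (fun x => q a + ∫ t in a..x, m t) a b ∧
      ∀ᵐ x, x ∈ Set.uIcc a b → deriv (fun x => q a + ∫ t in a..x, m t) x = m x := by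
    intro q m hm
    refine ⟨(hconst (q a)).add
      (hm.absolutelyContinuousOnInterval_intervalIntegral Set.left_mem_uIcc), ?_⟩
    filter_upwards [hm.ae_hasDerivAt_integral] with x hx hx'
    exact ((hx hx' a Set.left_mem_uIcc).const_add _).deriv
  obtain ⟨hP, hP'⟩ := key (q := p) hk
  obtain ⟨hG, hG'⟩ := key (q := φ) hh
  have hpe : ∀ x ∈ Set.Icc a b, p a + ∫ t in a..x, k t = p x := fun x hx => by
    rw [← hp x hx]; ring
  have hφe : ∀ x ∈ Set.Icc a b, φ a + ∫ t in a..x, h t = φ x := fun x hx => by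
    rw [← hφ x hx]; ring
  have := hP.integral_deriv_mul_eq_sub hG
  simp only [hpe b (Set.right_mem_Icc.2 hab), hφe b (Set.right_mem_Icc.2 hab),
    intervalIntegral.integral_same, add_zero] at this
  rw [← this]
  apply intervalIntegral.integral_congr_ae
  filter_upwards [hP', hG'] with x h1 h2 hx
  have hx1 : x ∈ Set.uIcc a b := Set.uIoc_subset_uIcc hx
  have hx2 : x ∈ Set.Icc a b := by rwa [Set.uIcc_of_le hab] at hx1
  rw [h1 hx1, h2 hx1, hpe x hx2, hφe x hx2]

/-- `u` solves `u'' = g u` on `(0, ∞)` in the sense of Carathéodory: `u` has the derivative `p`, and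
`p` is an indefinite integral of the locally integrable function `g u`. -/
structure IsCaratheodorySol (g u p : ℝ → ℝ) : Prop where
  hasDerivAt : ∀ r, 0 < r → HasDerivAt u (p r) r
  integrable : ∀ a b, 0 < a → a ≤ b → IntervalIntegrable (fun r => g r * u r) volume a b
  sub_eq_integral : ∀ a b, 0 < a → a ≤ b → p b - p a = ∫ r in a..b, g r * u r

namespace IsCaratheodorySol

variable {g u p g₁ u₁ p₁ : ℝ → ℝ}

theorem continuousOn (h : IsCaratheodorySol g u p) {a b : ℝ} (ha : 0 < a) :
    ContinuousOn u (Set.Icc a b) := fun x hx =>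
  (h.hasDerivAt x (ha.trans_le hx.1)).continuousAt.continuousWithinAt

theorem continuousOn_deriv (h : IsCaratheodorySol g u p) {a b : ℝ} (ha : 0 < a) (hab : a ≤ b) :
    ContinuousOn p (Set.Icc a b) := by
  have h1 := intervalIntegral.continuousOn_primitive_interval' (h.integrable a b ha hab)
    Set.left_mem_uIcc
  rw [Set.uIcc_of_le hab] at h1
  refine (h1.const_add (p a)).congr fun x hx => ?_
  linarith [h.sub_eq_integral a x ha hx.1]

theorem sub_eq_integral_deriv (h : IsCaratheodorySol g u p) {a b : ℝ} (ha : 0 < a) (hab : a ≤ b) :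
    u b - u a = ∫ r in a..b, p r := by
  refine (intervalIntegral.integral_eq_sub_of_hasDerivAt (fun x hx => ?_) ?_).symm
  · rw [Set.uIcc_of_le hab] at hx
    exact h.hasDerivAt x (ha.trans_le hx.1)
  · exact (h.continuousOn_deriv ha hab).intervalIntegrable_of_Icc hab

/-- A twice differentiable function solves the equation with coefficient `u'' / u`. -/
theorem of_hasDerivAt (h1 : ∀ r, 0 < r → HasDerivAt u (p r) r)
    (h2 : ∀ r, 0 < r → HasDerivAt p (g r * u r) r)
    (hg : ContinuousOn (fun r => g r * u r) (Set.Ioi 0)) : IsCaratheodorySol g u p := by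
  have hi : ∀ a b, 0 < a → a ≤ b → IntervalIntegrable (fun r => g r * u r) volume a b :=
    fun a b ha hab => (hg.mono fun x hx => ha.trans_le hx.1).intervalIntegrable_of_Icc hab
  refine ⟨h1, hi, fun a b ha hab => ?_⟩
  refine (intervalIntegral.integral_eq_sub_of_hasDerivAt (fun x hx => ?_) (hi a b ha hab)).symm
  rw [Set.uIcc_of_le hab] at hx
  exact h2 x (ha.trans_le hx.1)

/-- The Wronskian of solutions of `u'' = g u` and `u₁'' = g₁ u₁` has derivative
`(g - g₁) u u₁`. -/
theorem wronskian_sub (h : IsCaratheodorySol g u p) (h₁ : IsCaratheodorySol g₁ u₁ p₁) {a b : ℝ}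
    (ha : 0 < a) (hab : a ≤ b) :
    (p b * u₁ b - u b * p₁ b) - (p a * u₁ a - u a * p₁ a) =
      ∫ r in a..b, (g r - g₁ r) * (u r * u₁ r) := by
  have hc := h.continuousOn_deriv ha hab
  have hc₁ := h₁.continuousOn_deriv ha hab
  have e1 := mul_sub_mul_eq_integral_of_primitives hab (h.integrable a b ha hab)
    (hc₁.intervalIntegrable_of_Icc hab) (fun x hx => h.sub_eq_integral a x ha hx.1)
    (fun x hx => h₁.sub_eq_integral_deriv ha hx.1)
  have e2 := mul_sub_mul_eq_integral_of_primitives hab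
    (hc.intervalIntegrable_of_Icc hab) (h₁.integrable a b ha hab)
    (fun x hx => h.sub_eq_integral_deriv ha hx.1)
    (fun x hx => h₁.sub_eq_integral a x ha hx.1)
  have i1 : IntervalIntegrable (fun x => g x * u x * u₁ x) volume a b :=
    (h.integrable a b ha hab).mul_continuousOn (by
      rw [Set.uIcc_of_le hab]; exact h₁.continuousOn ha)
  have i2 : IntervalIntegrable (fun x => p x * p₁ x) volume a b :=
    (hc.mul hc₁).intervalIntegrable_of_Icc hab
  have i3 : IntervalIntegrable (fun x => u x * (g₁ x * u₁ x)) volume a b :=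
    (h₁.integrable a b ha hab).continuousOn_mul (by
      rw [Set.uIcc_of_le hab]; exact h.continuousOn ha)
  calc _ = (p b * u₁ b - p a * u₁ a) - (u b * p₁ b - u a * p₁ a) := by ring
    _ = _ := by
      rw [e1, e2, ← intervalIntegral.integral_sub (i1.add i2) (i2.add i3)]
      congr 1; ext r; ring

end IsCaratheodorySol

/-! ### Decay and asymptotics for second-order linear equations -/

namespace IsCaratheodorySol

variable {g u p : ℝ → ℝ}

theorem deriv_mono (h : IsCaratheodorySol g u p) (hu : ∀ r, 0 < r → 0 < u r) {R : ℝ} (hR : 0 < R)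
    (hg : ∀ r, R ≤ r → 0 ≤ g r) {a b : ℝ} (ha : R ≤ a) (hab : a ≤ b) : p a ≤ p b := by
  have := h.sub_eq_integral a b (hR.trans_le ha) hab
  have h0 : 0 ≤ ∫ r in a..b, g r * u r := intervalIntegral.integral_nonneg hab fun r hr =>
    mul_nonneg (hg r (ha.trans hr.1)) (hu r (hR.trans_le (ha.trans hr.1))).le
  linarith

/-- A positive convex solution growing more slowly than linearly is nonincreasing. -/
theorem deriv_nonpos (h : IsCaratheodorySol g u p) (hu : ∀ r, 0 < r → 0 < u r) {R : ℝ}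
    (hR : 0 < R) (hg : ∀ r, R ≤ r → 0 ≤ g r) (hlim : Tendsto (fun r => u r / r) atTop (𝓝 0))
    {r : ℝ} (hr : R ≤ r) : p r ≤ 0 := by
  have h1 : Tendsto (fun s : ℝ => p r + (u r - p r * r) / s) atTop (𝓝 (p r + 0)) :=
    tendsto_const_nhds.add (tendsto_const_nhds.div_atTop tendsto_id)
  rw [add_zero] at h1
  refine le_of_tendsto_of_tendsto h1 hlim ?_
  filter_upwards [eventually_ge_atTop r] with s hs
  have hr0 : 0 < r := hR.trans_le hr
  have hs0 : 0 < s := hr0.trans_le hs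
  have h2 := h.sub_eq_integral_deriv hr0 hs
  have h3 : ∫ _ in r..s, p r ≤ ∫ t in r..s, p t :=
    intervalIntegral.integral_mono_on hs intervalIntegrable_const
      ((h.continuousOn_deriv hr0 hs).intervalIntegrable_of_Icc hs)
      fun t ht => h.deriv_mono hu hR hg hr ht.1
  rw [intervalIntegral.integral_const, smul_eq_mul] at h3
  rw [le_div_iff₀ hs0, add_mul, div_mul_cancel₀ _ hs0.ne']
  nlinarith

theorem antitone (h : IsCaratheodorySol g u p) {R : ℝ} (hR : 0 < R) (hp : ∀ r, R ≤ r → p r ≤ 0)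
    {a b : ℝ} (ha : R ≤ a) (hab : a ≤ b) : u b ≤ u a := by
  have h1 := h.sub_eq_integral_deriv (hR.trans_le ha) hab
  have h2 : 0 ≤ ∫ t in a..b, -p t := intervalIntegral.integral_nonneg hab fun t ht =>
    neg_nonneg.2 (hp t (ha.trans ht.1))
  rw [intervalIntegral.integral_neg] at h2
  linarith

/-- If the coefficient is at least `1/4`, a positive sublinear solution is `O(exp (-r/2))`. The
Wronskian with `exp (-r/2)` is nondecreasing and tends to `0`, so it is nonpositive. -/
theorem exp_decay (h : IsCaratheodorySol g u p) (hu : ∀ r, 0 < r → 0 < u r) {R : ℝ}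
    (hR : 0 < R) (hg : ∀ r, R ≤ r → 1 / 4 ≤ g r)
    (hlim : Tendsto (fun r => u r / r) atTop (𝓝 0)) :
    ∃ C, 0 < C ∧ ∀ r, R ≤ r → u r ≤ C * exp (-r / 2) := by
  have hg0 : ∀ r, R ≤ r → 0 ≤ g r := fun r hr => le_trans (by norm_num) (hg r hr)
  have hp : ∀ r, R ≤ r → p r ≤ 0 := fun r hr => h.deriv_nonpos hu hR hg0 hlim hr
  have hw' : ∀ r : ℝ, HasDerivAt (fun r : ℝ => exp (-r / 2)) (-1 / 2 * exp (-r / 2)) r := by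
    intro r
    convert! (((hasDerivAt_id r).neg.div_const 2).exp) using 1
    simp; ring
  have hw : IsCaratheodorySol (fun _ => 1 / 4) (fun r => exp (-r / 2))
      (fun r => -1 / 2 * exp (-r / 2)) := by
    refine .of_hasDerivAt (fun r _ => hw' r) (fun r _ => ?_) (by fun_prop)
    convert! (hw' r).const_mul (-1 / 2) using 1; ring
  have hlim0 : Tendsto (fun r : ℝ => exp (-r / 2)) atTop (𝓝 0) := by
    refine tendsto_exp_atBot.comp ?_
    have := (tendsto_id (α := ℝ) (x := atTop)).const_mul_atTop (show (0 : ℝ) < 1 / 2 by norm_num)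
    exact (tendsto_neg_atTop_atBot.comp this).congr fun r => by simp; ring
  have hz : ∀ r, R ≤ r → p r + u r / 2 ≤ 0 := by
    intro r hr
    have hr0 : 0 < r := hR.trans_le hr
    have hle : p r * exp (-r / 2) - u r * (-1 / 2 * exp (-r / 2)) ≤ 0 := by
      have l1 : Tendsto (fun s : ℝ => u R * exp (-s / 2)) atTop (𝓝 (u R * 0)) :=
        tendsto_const_nhds.mul hlim0
      rw [mul_zero] at l1
      refine ge_of_tendsto l1 ?_
      filter_upwards [eventually_ge_atTop r] with s hs
      have e := h.wronskian_sub hw hr0 hs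
      have e0 : 0 ≤ ∫ t in r..s, (g t - 1 / 4) * (u t * exp (-t / 2)) :=
        intervalIntegral.integral_nonneg hs fun t ht =>
          mul_nonneg (sub_nonneg.2 (hg t (hr.trans ht.1)))
            (mul_nonneg (hu t (hr0.trans_le ht.1)).le (exp_pos _).le)
      have e1 := hp s (hr.trans hs)
      have e2 := h.antitone hR hp le_rfl (hr.trans hs)
      have e3 := hu s (hr0.trans_le hs)
      have e4 := exp_pos (-s / 2)
      have e5 : p s * exp (-s / 2) ≤ 0 := mul_nonpos_of_nonpos_of_nonneg e1 e4.le
      have e6 : u s * exp (-s / 2) ≤ u R * exp (-s / 2) := by gcongr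
      have e7 := mul_pos e3 e4
      linarith
    have e4 := exp_pos (-r / 2)
    by_contra! hcon
    nlinarith [mul_pos hcon e4]
  refine ⟨u R * exp (R / 2), mul_pos (hu R hR) (exp_pos _), fun r hr => ?_⟩
  have hd : ∀ x, 0 < x → HasDerivAt (fun x => u x * exp (x / 2))
      ((p x + u x / 2) * exp (x / 2)) x := by
    intro x hx
    convert! (h.hasDerivAt x hx).mul (((hasDerivAt_id x).div_const 2).exp) using 1
    simp; ring
  have hanti : AntitoneOn (fun x => u x * exp (x / 2)) (Set.Ici R) := by
    refine antitoneOn_of_deriv_nonpos (convex_Ici R)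
      (fun x hx => (hd x (hR.trans_le hx)).continuousAt.continuousWithinAt)
      (fun x hx => ?_) (fun x hx => ?_)
    · rw [interior_Ici] at hx
      exact (hd x (hR.trans hx)).differentiableAt.differentiableWithinAt
    · rw [interior_Ici] at hx
      rw [(hd x (hR.trans hx)).deriv]
      exact mul_nonpos_of_nonpos_of_nonneg (hz x (le_of_lt hx)) (exp_pos _).le
  have := hanti (Set.mem_Ici.2 le_rfl) (Set.mem_Ici.2 hr) hr
  simp only at this
  rw [show -r / 2 = -(r / 2) by ring, exp_neg, ← div_eq_mul_inv, le_div_iff₀ (exp_pos _)]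
  exact this

end IsCaratheodorySol

/-- The comparison function `r ^ κ * exp (-r)` solves an equation whose coefficient differs from
`1 - 2 κ / r` by `O(r⁻²)`. -/
theorem isCaratheodorySol_rpow_mul_exp_neg (κ : ℝ) :
    IsCaratheodorySol (fun r => 1 - 2 * κ / r + (κ ^ 2 - κ) / r ^ 2)
      (fun r => r ^ κ * exp (-r)) (fun r => (κ / r - 1) * (r ^ κ * exp (-r))) := by
  have h1 : ∀ r : ℝ, 0 < r → HasDerivAt (fun r : ℝ => r ^ κ * exp (-r))
      ((κ / r - 1) * (r ^ κ * exp (-r))) r := by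
    intro r hr
    convert! (Real.hasDerivAt_rpow_const (p := κ) (Or.inl hr.ne')).mul
      ((hasDerivAt_id r).neg.exp) using 1
    rw [Real.rpow_sub_one hr.ne']
    simp; ring
  refine .of_hasDerivAt h1 (fun r hr => ?_) (fun r hr => ?_)
  · convert! (((hasDerivAt_const r κ).div (hasDerivAt_id r) hr.ne').sub_const 1).mul (h1 r hr)
      using 1
    have := hr.ne'
    simp; field_simp; ring
  · have h2 := (h1 r hr).continuousAt.continuousWithinAt (s := Set.Ioi 0)
    have hr' : r ≠ 0 := (ne_of_gt hr)
    refine ContinuousWithinAt.mul (ContinuousAt.continuousWithinAt ?_) h2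
    exact ((continuousAt_const.sub (continuousAt_const.div continuousAt_id hr')).add
      (continuousAt_const.div (continuousAt_id.pow 2) (pow_ne_zero 2 hr')))

namespace IsCaratheodorySol

variable {g u p : ℝ → ℝ}

/-- A positive nonincreasing solution of `u'' = (1 - 2κ/r + O(r⁻²)) u` is asymptotic to a positive
multiple of `r ^ κ * exp (-r)`. The Wronskian `D` with `w = r ^ κ * exp (-r)` vanishes at infinity,
hence is `O(r⁻² u w)`, and `D / (u w)` is the derivative of `log (u / w)`. -/
theorem exists_tendsto (h : IsCaratheodorySol g u p) (hu : ∀ r, 0 < r → 0 < u r) {R κ C : ℝ}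
    (hR : 0 < R) (hg0 : ∀ r, R ≤ r → 0 ≤ g r) (hp : ∀ r, R ≤ r → p r ≤ 0)
    (hg : ∀ r, R ≤ r → |g r - (1 - 2 * κ / r)| ≤ C / r ^ 2) :
    ∃ l, 0 < l ∧ Tendsto (fun r => u r * r ^ (-κ) * exp r) atTop (𝓝 l) := by
  set w : ℝ → ℝ := fun r => r ^ κ * exp (-r) with hw
  have hcmp := isCaratheodorySol_rpow_mul_exp_neg κ
  have hwpos : ∀ r, 0 < r → 0 < w r := fun r hr => mul_pos (rpow_pos_of_pos hr _) (exp_pos _)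
  have hw0 : Tendsto w atTop (𝓝 0) := by
    simpa using! tendsto_rpow_mul_exp_neg_mul_atTop_nhds_zero κ 1 one_pos
  set A := C + |κ ^ 2 - κ| with hA
  -- beyond `S` one has `w' ≤ -w / 2`
  set S := max R (max 1 (2 * |κ|)) with hS
  have hRS : R ≤ S := le_max_left _ _
  have hS1 : 1 ≤ S := (le_max_left _ _).trans (le_max_right _ _)
  have hSκ : 2 * |κ| ≤ S := (le_max_right _ _).trans (le_max_right _ _)
  have hκ : ∀ r, S ≤ r → |κ / r| ≤ 1 / 2 := by
    intro r hr
    have : 0 < r := by linarith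
    rw [abs_div, abs_of_pos this, div_le_iff₀ this]
    linarith
  have hgw : ∀ r, S ≤ r → |g r - (1 - 2 * κ / r + (κ ^ 2 - κ) / r ^ 2)| ≤ A / r ^ 2 := by
    intro r hr
    have hr0 : 0 < r := by linarith
    have e1 := hg r (hRS.trans hr)
    have e2 : |(κ ^ 2 - κ) / r ^ 2| = |κ ^ 2 - κ| / r ^ 2 := by
      rw [abs_div, abs_of_pos (pow_pos hr0 2)]
    calc _ = |(g r - (1 - 2 * κ / r)) - (κ ^ 2 - κ) / r ^ 2| := by congr 1; ring
      _ ≤ |g r - (1 - 2 * κ / r)| + |(κ ^ 2 - κ) / r ^ 2| := abs_sub _ _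
      _ ≤ C / r ^ 2 + |κ ^ 2 - κ| / r ^ 2 := by rw [e2]; gcongr
      _ = A / r ^ 2 := by rw [hA]; ring
  have hA0 : 0 ≤ A := by
    have := (abs_nonneg _).trans (hgw S le_rfl)
    by_contra! hcon
    exact absurd this (not_le.2 (div_neg_of_neg_of_pos hcon (by positivity)))
  set D : ℝ → ℝ := fun r => p r * w r - u r * ((κ / r - 1) * w r) with hD
  have hDlim : Tendsto D atTop (𝓝 0) := by
    have l1 : Tendsto (fun s : ℝ => (|p S| + u S * (3 / 2)) * w s) atTop
        (𝓝 ((|p S| + u S * (3 / 2)) * 0)) := tendsto_const_nhds.mul hw0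
    rw [mul_zero] at l1
    refine squeeze_zero_norm' ?_ l1
    filter_upwards [eventually_ge_atTop S] with s hs
    have hs0 : 0 < s := by linarith
    have e1 : |p s| ≤ |p S| := by
      rw [abs_of_nonpos (hp s (hRS.trans hs)), abs_of_nonpos (hp S hRS)]
      linarith [h.deriv_mono hu hR hg0 hRS hs]
    have e2 : u s ≤ u S := h.antitone hR hp hRS hs
    have e3 : |κ / s - 1| ≤ 3 / 2 := by
      have := abs_le.1 (hκ s hs)
      rw [abs_le]; constructor <;> linarith
    have e4 := hu s hs0
    calc ‖D s‖ = |(p s - u s * (κ / s - 1)) * w s| := by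
          rw [hD, Real.norm_eq_abs]; congr 1; ring
      _ = |p s - u s * (κ / s - 1)| * w s := by rw [abs_mul, abs_of_pos (hwpos s hs0)]
      _ ≤ (|p s| + |u s * (κ / s - 1)|) * w s :=
          mul_le_mul_of_nonneg_right (abs_sub _ _) (hwpos s hs0).le
      _ ≤ (|p S| + u S * (3 / 2)) * w s := by
          rw [abs_mul, abs_of_pos e4]
          have := (hwpos s hs0).le
          have := e4.le.trans e2
          gcongr
  have hDle : ∀ r, S ≤ r → |D r| ≤ 2 * A / r ^ 2 * (u r * w r) := by
    intro r hr
    have hr0 : 0 < r := by linarith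
    have l1 : Tendsto (fun s => |D s - D r|) atTop (𝓝 |0 - D r|) :=
      (hDlim.sub tendsto_const_nhds).abs
    rw [zero_sub, abs_neg] at l1
    refine le_of_tendsto l1 ?_
    filter_upwards [eventually_ge_atTop r] with s hs
    have hs0 : 0 < s := by linarith
    have hci : IntervalIntegrable (fun t => (κ / t - 1) * w t) volume r s :=
      (hcmp.continuousOn_deriv hr0 hs).intervalIntegrable_of_Icc hs
    have e1 : D s - D r = _ := h.wronskian_sub hcmp hr0 hs
    have e2 : ‖∫ t in r..s, (g t - (1 - 2 * κ / t + (κ ^ 2 - κ) / t ^ 2)) * (u t * w t)‖ ≤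
        ∫ t in r..s, -(2 * A / r ^ 2 * u r) * ((κ / t - 1) * w t) := by
      refine intervalIntegral.norm_integral_le_of_norm_le hs (ae_of_all _ fun t ht => ?_)
        (hci.const_mul _)
      have ht0 : 0 < t := hr0.trans ht.1
      have f1 := hgw t (hr.trans ht.1.le)
      have f2 : A / t ^ 2 ≤ A / r ^ 2 := by
        have := ht.1.le
        gcongr
      have f3 : u t ≤ u r := h.antitone hR hp (hRS.trans hr) ht.1.le
      have f4 := (abs_le.1 (hκ t (hr.trans ht.1.le))).2
      have f5 := hwpos t ht0
      have f6 := hu t ht0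
      rw [Real.norm_eq_abs, abs_mul, abs_of_pos (mul_pos f6 f5)]
      calc _ ≤ A / r ^ 2 * (u r * w t) := by
            have := f1.trans f2
            gcongr
        _ = (2 * A / r ^ 2 * u r) * (1 / 2 * w t) := by ring
        _ ≤ (2 * A / r ^ 2 * u r) * ((1 - κ / t) * w t) := by
            have := hu r hr0
            gcongr
            linarith
        _ = _ := by ring
    rw [e1]
    refine e2.trans ?_
    rw [intervalIntegral.integral_const_mul, ← hcmp.sub_eq_integral_deriv hr0 hs]
    have f5 := hwpos s hs0
    have f7 : 0 ≤ 2 * A / r ^ 2 * u r := mul_nonneg (by positivity) (hu r hr0).le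
    have f8 := mul_nonneg f7 f5.le
    calc _ = 2 * A / r ^ 2 * u r * w r - 2 * A / r ^ 2 * u r * w s := by
          simp only [hw]; ring
      _ ≤ _ := by linarith
  have hLd : ∀ r, 0 < r → HasDerivAt (fun r => log (u r) - κ * log r + r)
      (p r / u r - κ * r⁻¹ + 1) r := fun r hr =>
    (((h.hasDerivAt r hr).log (hu r hr).ne').sub
      ((Real.hasDerivAt_log hr.ne').const_mul κ)).add (hasDerivAt_id r)
  have hLbd : ∀ r, S < r → ‖p r / u r - κ * r⁻¹ + 1‖ ≤ 2 * A * r ^ (-2 : ℝ) := by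
    intro r hr
    have hr0 : 0 < r := by linarith
    have f5 := hwpos r hr0
    have f6 := hu r hr0
    have e : p r / u r - κ * r⁻¹ + 1 = D r / (u r * w r) := by
      rw [hD]; field_simp; ring
    rw [e, Real.norm_eq_abs, abs_div, abs_of_pos (mul_pos f6 f5), div_le_iff₀ (mul_pos f6 f5),
      Real.rpow_neg hr0.le, Real.rpow_two, ← div_eq_mul_inv]
    exact hDle r hr.le
  have hcont : ContinuousOn (fun r => p r / u r - κ * r⁻¹ + 1) (Set.Ioi S) := by
    intro r hr
    have hr' : S < r := hr
    have hr0 : 0 < r := by linarith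
    have c1 : ContinuousAt p r :=
      (h.continuousOn_deriv (a := r / 2) (b := r + 1) (by linarith) (by linarith)).continuousAt
        (Icc_mem_nhds (by linarith) (by linarith))
    have c2 := (h.hasDerivAt r hr0).continuousAt
    exact (((c1.div c2 (hu r hr0).ne').sub (continuousAt_const.mul
      (continuousAt_inv₀ hr0.ne'))).add continuousAt_const).continuousWithinAt
  have hint : IntegrableOn (fun r => p r / u r - κ * r⁻¹ + 1) (Set.Ioi S) := by
    refine Integrable.mono' (g := fun r => 2 * A * r ^ (-2 : ℝ))
      ((integrableOn_Ioi_rpow_of_lt (by norm_num) (by linarith)).const_mul _)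
      (hcont.aestronglyMeasurable measurableSet_Ioi) ?_
    exact (ae_restrict_iff' measurableSet_Ioi).2 (ae_of_all _ hLbd)
  have hL := tendsto_limUnder_of_hasDerivAt_of_integrableOn_Ioi
    (fun r (hr : r ∈ Set.Ioi S) => hLd r (by have : S < r := hr; linarith)) hint
  refine ⟨_, exp_pos _, ((continuous_exp.tendsto _).comp hL).congr' ?_⟩
  filter_upwards [eventually_gt_atTop 0] with r hr
  rw [Function.comp_apply, exp_add, exp_sub, exp_log (hu r hr), rpow_def_of_pos hr,
    mul_neg, exp_neg, mul_comm (log r) κ, div_eq_mul_inv]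

end IsCaratheodorySol

/-! ### Weak second derivatives on the half-line -/

/-- Test functions on `(0, ∞)`: smooth functions on `ℝ` vanishing off some `[a, b]` with `0 < a`. -/
structure IsHalfLineTest (η : ℝ → ℝ) : Prop where
  contDiff : ContDiff ℝ ∞ η
  exists_support : ∃ a b, 0 < a ∧ a ≤ b ∧ ∀ x, x ∉ Set.Icc a b → η x = 0

namespace IsHalfLineTest

variable {η ψ : ℝ → ℝ}

theorem of_tsupport (h1 : ContDiff ℝ ∞ η) (h2 : HasCompactSupport η)
    (h3 : tsupport η ⊆ Set.Ioi 0) : IsHalfLineTest η := by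
  refine ⟨h1, ?_⟩
  rcases (tsupport η).eq_empty_or_nonempty with he | hne
  · exact ⟨1, 1, one_pos, le_rfl, fun x _ => by
      rw [tsupport_eq_empty_iff.1 he]; rfl⟩
  · obtain ⟨a, ha⟩ := h2.isCompact.exists_isLeast hne
    obtain ⟨b, hb⟩ := h2.isCompact.exists_isGreatest hne
    refine ⟨a, b, h3 ha.1, ha.2 hb.1, fun x hx => image_eq_zero_of_notMem_tsupport fun hx' => ?_⟩
    exact hx ⟨ha.2 hx', hb.2 hx'⟩

theorem continuous (h : IsHalfLineTest η) : Continuous η := h.contDiff.continuous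

theorem differentiable (h : IsHalfLineTest η) : Differentiable ℝ η :=
  h.contDiff.differentiable (by simp)

theorem deriv (h : IsHalfLineTest η) : IsHalfLineTest (deriv η) := by
  refine ⟨(contDiff_infty_iff_deriv.1 h.contDiff).2, ?_⟩
  obtain ⟨a, b, ha, hab, h0⟩ := h.exists_support
  refine ⟨a, b, ha, hab, fun x hx => ?_⟩
  have : η =ᶠ[𝓝 x] fun _ => 0 := by
    filter_upwards [isClosed_Icc.isOpen_compl.mem_nhds hx] with y hy using h0 y hy
  rw [this.deriv_eq, deriv_const]

theorem sub (h : IsHalfLineTest η) (h' : IsHalfLineTest ψ) :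
    IsHalfLineTest (fun x => η x - ψ x) := by
  refine ⟨h.contDiff.sub h'.contDiff, ?_⟩
  obtain ⟨a, b, ha, hab, h0⟩ := h.exists_support
  obtain ⟨a', b', ha', hab', h0'⟩ := h'.exists_support
  refine ⟨min a a', max b b', lt_min ha ha', (min_le_left _ _).trans (hab.trans (le_max_left _ _)),
    fun x hx => ?_⟩
  rw [h0 x fun hx' => hx ⟨(min_le_left _ _).trans hx'.1, hx'.2.trans (le_max_left _ _)⟩,
    h0' x fun hx' => hx ⟨(min_le_right _ _).trans hx'.1, hx'.2.trans (le_max_right _ _)⟩, sub_zero]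

theorem const_mul (h : IsHalfLineTest η) (c : ℝ) : IsHalfLineTest (fun x => c * η x) := by
  refine ⟨contDiff_const.mul h.contDiff, ?_⟩
  obtain ⟨a, b, ha, hab, h0⟩ := h.exists_support
  exact ⟨a, b, ha, hab, fun x hx => by rw [h0 x hx, mul_zero]⟩

theorem integrable_mul {f : ℝ → ℝ} (h : IsHalfLineTest η)
    (hf : ∀ a b, 0 < a → a ≤ b → IntervalIntegrable f volume a b) :
    Integrable (fun x => f x * η x) := by
  obtain ⟨a, b, ha, hab, h0⟩ := h.exists_support
  have h1 := hf a b ha hab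
  rw [intervalIntegrable_iff_integrableOn_Icc_of_le hab] at h1
  refine (integrableOn_iff_integrable_of_support_subset (s := Set.Icc a b) ?_).1
    (h1.mul_continuousOn h.continuous.continuousOn isCompact_Icc)
  intro x hx
  by_contra hx'
  exact hx (by simp [h0 x hx'])

theorem integrable (h : IsHalfLineTest η) : Integrable η := by
  simpa using h.integrable_mul (f := fun _ => 1) fun a b _ _ => intervalIntegrable_const

theorem exists_integral_eq_one : ∃ ρ, IsHalfLineTest ρ ∧ ∫ x, ρ x = 1 := by
  let f : ContDiffBump (2 : ℝ) := ⟨1 / 2, 1, by norm_num, by norm_num⟩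
  refine ⟨f.normed volume, .of_tsupport f.contDiff_normed f.hasCompactSupport_normed ?_,
    f.integral_normed⟩
  rw [f.tsupport_normed_eq, Real.closedBall_eq_Icc]
  intro x hx
  have : (2 : ℝ) - 1 ≤ x := hx.1
  exact Set.mem_Ioi.2 (by linarith)

/-- A test function is the derivative of a test function when its integral vanishes. -/
theorem exists_deriv_eq (h : IsHalfLineTest ψ) (h0 : ∫ x, ψ x = 0) :
    ∃ η, IsHalfLineTest η ∧ _root_.deriv η = ψ := by
  obtain ⟨a, b, ha, hab, hs⟩ := h.exists_support
  have hd : ∀ x, HasDerivAt (fun x => ∫ t in a..x, ψ t) (ψ x) x := fun x =>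
    h.continuous.integral_hasStrictDerivAt a x |>.hasDerivAt
  have hde : _root_.deriv (fun x => ∫ t in a..x, ψ t) = ψ := funext fun x => (hd x).deriv
  refine ⟨fun x => ∫ t in a..x, ψ t, ⟨?_, a, b, ha, hab, fun x hx => ?_⟩, hde⟩
  · rw [contDiff_infty_iff_deriv, hde]
    exact ⟨fun x => (hd x).differentiableAt, h.contDiff⟩
  · rcases lt_or_ge x a with hxa | hxa
    · rw [intervalIntegral.integral_symm, neg_eq_zero,
        intervalIntegral.integral_of_le hxa.le, ← integral_Ico_eq_integral_Ioc]
      exact setIntegral_eq_zero_of_forall_eq_zero fun t ht => hs t fun ht' =>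
        absurd ht.2 (not_lt.2 ht'.1)
    · have hxb : b < x := by
        by_contra! hcon
        exact hx ⟨hxa, hcon⟩
      rw [intervalIntegral.integral_of_le hxa, ← integral_Icc_eq_integral_Ioc,
        setIntegral_eq_integral_of_forall_compl_eq_zero, h0]
      exact fun t ht => hs t fun ht' => ht ⟨ht'.1, ht'.2.trans hxb.le⟩

theorem integral_id_mul_deriv (h : IsHalfLineTest η) :
    ∫ x, x * _root_.deriv η x = -∫ x, η x := by
  have := integral_mul_deriv_eq_deriv_mul_of_integrable (u := fun x : ℝ => x) (u' := fun _ => 1)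
    (v := η) (v' := _root_.deriv η) (fun x _ => hasDerivAt_id x)
    (fun x _ => (h.differentiable x).hasDerivAt)
    (h.deriv.integrable_mul fun a b _ _ => continuous_id.intervalIntegrable a b)
    (h.integrable_mul fun a b _ _ => intervalIntegrable_const)
    (h.integrable_mul fun a b _ _ => continuous_id.intervalIntegrable a b)
  simpa using this

end IsHalfLineTest

theorem ContinuousOn.intervalIntegrable_of_pos {h : ℝ → ℝ} (hc : ContinuousOn h (Set.Ioi 0)) :
    ∀ a b, 0 < a → a ≤ b → IntervalIntegrable h volume a b := fun _ _ ha hab =>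
  (hc.mono fun _ hx => ha.trans_le hx.1).intervalIntegrable_of_Icc hab

/-- The lemma of du Bois-Reymond: a continuous function with vanishing weak derivative is
constant. -/
theorem eq_const_of_integral_mul_deriv_eq_zero {h : ℝ → ℝ} (hc : ContinuousOn h (Set.Ioi 0))
    (h0 : ∀ η, IsHalfLineTest η → ∫ x, h x * deriv η x = 0) :
    ∃ c, ∀ x, 0 < x → h x = c := by
  obtain ⟨ρ, hρ, hρ1⟩ := IsHalfLineTest.exists_integral_eq_one
  set c := ∫ x, h x * ρ x
  have hint := hc.intervalIntegrable_of_pos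
  have hae : ∀ᵐ x : ℝ, x ∈ Set.Ioi 0 → h x - c = 0 := by
    refine isOpen_Ioi.ae_eq_zero_of_integral_contDiff_smul_eq_zero
      ((hc.sub continuousOn_const).locallyIntegrableOn measurableSet_Ioi) fun ψ h1 h2 h3 => ?_
    have hψ := IsHalfLineTest.of_tsupport h1 h2 h3
    obtain ⟨η, hη, hd⟩ := (hψ.sub (hρ.const_mul (∫ x, ψ x))).exists_deriv_eq (by
      rw [integral_sub hψ.integrable (hρ.const_mul _).integrable, integral_const_mul, hρ1]; ring)
    have e := h0 η hη
    have e1 : (fun x => h x * deriv η x) = fun x => h x * ψ x - (∫ x, ψ x) * (h x * ρ x) := by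
      funext x; rw [hd]; ring
    rw [e1, integral_sub (hψ.integrable_mul hint) ((hρ.integrable_mul hint).const_mul _),
      integral_const_mul] at e
    have e2 : (fun x => ψ x • (h x - c)) = fun x => h x * ψ x - c * ψ x := by
      funext x; rw [smul_eq_mul]; ring
    rw [e2, integral_sub (hψ.integrable_mul hint) (hψ.integrable.const_mul _), integral_const_mul]
    linarith
  refine ⟨c, fun x hx => ?_⟩
  exact Measure.eqOn_open_of_ae_eq (μ := volume) (U := Set.Ioi 0) (f := h) (g := fun _ => c)
    ((ae_restrict_iff' measurableSet_Ioi).2 (hae.mono fun x hx hx' => sub_eq_zero.1 (hx hx')))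
    isOpen_Ioi hc continuousOn_const hx

/-- A continuous function with vanishing weak second derivative is affine: the slope is read off from
one test function `ρ` of integral `1`, since `η - (∫ η) ρ` is a derivative for every `η`. -/
theorem eq_affine_of_integral_mul_deriv_deriv_eq_zero {h : ℝ → ℝ}
    (hc : ContinuousOn h (Set.Ioi 0))
    (h0 : ∀ η, IsHalfLineTest η → ∫ x, h x * deriv (deriv η) x = 0) :
    ∃ m c, ∀ x, 0 < x → h x = m * x + c := by
  obtain ⟨ρ, hρ, hρ1⟩ := IsHalfLineTest.exists_integral_eq_one
  set m := -∫ x, h x * deriv ρ x with hm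
  have hint := hc.intervalIntegrable_of_pos
  obtain ⟨c, hcc⟩ := eq_const_of_integral_mul_deriv_eq_zero (h := fun x => h x - m * x)
    (hc.sub (by fun_prop)) fun η hη => by
      obtain ⟨ζ, hζ, hd⟩ := (hη.sub (hρ.const_mul (∫ x, η x))).exists_deriv_eq (by
        rw [integral_sub hη.integrable (hρ.const_mul _).integrable, integral_const_mul, hρ1]; ring)
      have e := h0 ζ hζ
      have e1 : (fun x => h x * deriv (deriv ζ) x) =
          fun x => h x * deriv η x - (∫ x, η x) * (h x * deriv ρ x) := by
        funext x
        rw [hd, deriv_fun_sub (hη.differentiable x) ((hρ.differentiable x).const_mul _),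
          deriv_const_mul _ (hρ.differentiable x)]
        ring
      rw [e1, integral_sub (hη.deriv.integrable_mul hint)
        ((hρ.deriv.integrable_mul hint).const_mul _), integral_const_mul] at e
      have e2 : (fun x => (h x - m * x) * deriv η x) =
          fun x => h x * deriv η x - m * (x * deriv η x) := by
        funext x; ring
      rw [e2, integral_sub (hη.deriv.integrable_mul hint)
        ((hη.deriv.integrable_mul (f := fun x => x) fun a b _ _ => continuous_id.intervalIntegrable a b).const_mul _),
        integral_const_mul, hη.integral_id_mul_deriv, hm]
      linarith
  exact ⟨m, c, fun x hx => by linarith [hcc x hx]⟩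

/-- A continuous function whose weak second derivative is a locally integrable function `k` has a
classical derivative, and that derivative is an indefinite integral of `k`. -/
theorem exists_hasDerivAt_of_integral_mul_deriv_deriv_eq {u k : ℝ → ℝ}
    (hu : ContinuousOn u (Set.Ioi 0))
    (hk : ∀ a b, 0 < a → a ≤ b → IntervalIntegrable k volume a b)
    (hw : ∀ η, IsHalfLineTest η → ∫ x, u x * deriv (deriv η) x = ∫ x, k x * η x) :
    ∃ p : ℝ → ℝ, (∀ r, 0 < r → HasDerivAt u (p r) r) ∧
      ∀ a b, 0 < a → a ≤ b → p b - p a = ∫ r in a..b, k r := by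
  have hk' : ∀ a b, 0 < a → 0 < b → IntervalIntegrable k volume a b := fun a b ha hb => by
    rcases le_total a b with h | h
    exacts [hk a b ha h, (hk b a hb h).symm]
  set K : ℝ → ℝ := fun x => ∫ t in (1 : ℝ)..x, k t with hKdef
  have hKsub : ∀ a b, 0 < a → 0 < b → K b - K a = ∫ r in a..b, k r := fun a b ha hb =>
    intervalIntegral.integral_interval_sub_left (hk' 1 b one_pos hb) (hk' 1 a one_pos ha)
  have hKc : ContinuousOn K (Set.Ioi 0) := by
    intro x hx
    have hx0 : 0 < x := hx
    have h1 := intervalIntegral.continuousOn_primitive_interval'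
      (hk' (min 1 (x / 2)) (x + 1) (lt_min one_pos (by linarith)) (by linarith))
      (a := 1) (by
        rw [Set.uIcc_of_le ((min_le_left _ _).trans (by linarith))]
        exact ⟨min_le_left _ _, by linarith⟩)
    rw [Set.uIcc_of_le ((min_le_left _ _).trans (by linarith))] at h1
    refine (h1.continuousAt (Icc_mem_nhds ?_ (by linarith))).continuousWithinAt
    exact (min_le_right _ _).trans_lt (by linarith)
  have hKi := hKc.intervalIntegrable_of_pos
  set J : ℝ → ℝ := fun x => ∫ t in (1 : ℝ)..x, K t with hJdef
  have hJd : ∀ x, 0 < x → HasDerivAt J (K x) x := by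
    intro x hx
    refine intervalIntegral.integral_hasDerivAt_right ?_
      (hKc.stronglyMeasurableAtFilter isOpen_Ioi x hx) (hKc.continuousAt (Ioi_mem_nhds hx))
    rcases le_total 1 x with h | h
    exacts [hKi 1 x one_pos h, (hKi x 1 hx h).symm]
  have hJc : ContinuousOn J (Set.Ioi 0) := fun x hx => (hJd x hx).continuousAt.continuousWithinAt
  have hJsub : ∀ a b, 0 < a → a ≤ b → J b - J a = ∫ r in a..b, K r := fun a b ha hab => by
    refine (intervalIntegral.integral_eq_sub_of_hasDerivAt (fun x hx => hJd x ?_)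
      (hKi a b ha hab)).symm
    rw [Set.uIcc_of_le hab] at hx
    exact ha.trans_le hx.1
  have hparts : ∀ η, IsHalfLineTest η → ∫ x, k x * η x = ∫ x, J x * deriv (deriv η) x := by
    intro η hη
    -- integrate by parts twice over an interval whose end points lie off the support
    have hsupp : ∃ a b, 0 < a ∧ a ≤ b ∧ (∀ x, x ∉ Set.Ioc a b → η x = 0) ∧
        (∀ x, x ∉ Set.Ioc a b → deriv η x = 0) ∧ (∀ x, x ∉ Set.Ioc a b → deriv (deriv η) x = 0) ∧
        η a = 0 ∧ η b = 0 ∧ deriv η a = 0 ∧ deriv η b = 0 := by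
      obtain ⟨a, b, ha, hab, h0⟩ := hη.exists_support
      have hloc : ∀ {f : ℝ → ℝ}, (∀ x, x ∉ Set.Icc a b → f x = 0) →
          ∀ x, x ∉ Set.Icc a b → deriv f x = 0 := fun {f} hf x hx => by
        have : f =ᶠ[𝓝 x] fun _ => 0 := by
          filter_upwards [isClosed_Icc.isOpen_compl.mem_nhds hx] with y hy using hf y hy
        rw [this.deriv_eq, deriv_const]
      have h1 := hloc h0
      have h2 := hloc h1
      have hm : ∀ x, x ∉ Set.Ioc (a / 2) (b + 1) → x ∉ Set.Icc a b := fun x hx hx' =>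
        hx ⟨by linarith [hx'.1], by linarith [hx'.2]⟩
      have ma : a / 2 ∉ Set.Icc a b := fun h => by linarith [h.1]
      have mb : b + 1 ∉ Set.Icc a b := fun h => by linarith [h.2]
      exact ⟨a / 2, b + 1, by linarith, by linarith, fun x hx => h0 x (hm x hx),
        fun x hx => h1 x (hm x hx), fun x hx => h2 x (hm x hx), h0 _ ma, h0 _ mb, h1 _ ma, h1 _ mb⟩
    obtain ⟨a, b, ha, hab, s0, s1, s2, ea, eb, ea', eb'⟩ := hsupp
    have hFTC : ∀ {f : ℝ → ℝ}, IsHalfLineTest f → ∀ x, f x - f a = ∫ t in a..x, deriv f t :=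
      fun {f} hf x => (intervalIntegral.integral_eq_sub_of_hasDerivAt
        (fun y _ => (hf.differentiable y).hasDerivAt)
        (hf.deriv.continuous.intervalIntegrable _ _)).symm
    have e1 := mul_sub_mul_eq_integral_of_primitives hab (hk a b ha hab)
      (hη.deriv.continuous.intervalIntegrable a b)
      (fun x hx => hKsub a x ha (ha.trans_le hx.1)) (fun x _ => hFTC hη x)
    have e2 := mul_sub_mul_eq_integral_of_primitives hab (hKi a b ha hab)
      (hη.deriv.deriv.continuous.intervalIntegrable a b)
      (fun x hx => hJsub a x ha hx.1) (fun x _ => hFTC hη.deriv x)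
    rw [ea, eb, intervalIntegral.integral_add
      ((hk a b ha hab).mul_continuousOn hη.continuous.continuousOn)
      ((hKi a b ha hab).mul_continuousOn hη.deriv.continuous.continuousOn)] at e1
    rw [ea', eb', intervalIntegral.integral_add
      ((hKi a b ha hab).mul_continuousOn hη.deriv.continuous.continuousOn)
      ((hJc.intervalIntegrable_of_pos a b ha hab).mul_continuousOn
        hη.deriv.deriv.continuous.continuousOn)] at e2
    have hext : ∀ {f ζ : ℝ → ℝ}, (∀ x, x ∉ Set.Ioc a b → ζ x = 0) →
        ∫ x, f x * ζ x = ∫ x in a..b, f x * ζ x := fun {f ζ} hζ => by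
      rw [intervalIntegral.integral_of_le hab, setIntegral_eq_integral_of_forall_compl_eq_zero]
      exact fun x hx => by rw [hζ x hx, mul_zero]
    rw [hext s0, hext s2]
    linarith
  obtain ⟨m, c, hmc⟩ := eq_affine_of_integral_mul_deriv_deriv_eq_zero (hu.sub hJc) fun η hη => by
    have e : (fun x => (u - J) x * deriv (deriv η) x) =
        fun x => u x * deriv (deriv η) x - J x * deriv (deriv η) x := by
      funext x; rw [Pi.sub_apply]; ring
    rw [e, integral_sub (hη.deriv.deriv.integrable_mul hu.intervalIntegrable_of_pos)
      (hη.deriv.deriv.integrable_mul hJc.intervalIntegrable_of_pos), hw η hη, hparts η hη, sub_self]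
  refine ⟨fun r => K r + m, fun r hr => ?_, fun a b ha hab => ?_⟩
  · have h1 : HasDerivAt (fun x => J x + (m * x + c)) (K r + m) r := by
      convert! (hJd r hr).add (((hasDerivAt_id r).const_mul m).add_const c) using 1
      simp
    refine h1.congr_of_eventuallyEq ?_
    filter_upwards [Ioi_mem_nhds hr] with x hx
    rw [← hmc x hx, Pi.sub_apply]; ring
  · rw [← hKsub a b ha (ha.trans_le hab)]; ring

/-! ### Radial test functions -/

/-- The Laplacian of `G(|x|²)` in `ℝ³`. -/
theorem laplacian_comp_norm_sq {G : ℝ → ℝ} (hG : ContDiff ℝ ∞ G) (x : E3) :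
    (Δ fun y : E3 => G (‖y‖ ^ 2)) x =
      4 * ‖x‖ ^ 2 * deriv (deriv G) (‖x‖ ^ 2) + 6 * deriv G (‖x‖ ^ 2) := by
  have hG1 := (contDiff_infty_iff_deriv.1 hG).2
  have hd0 : ∀ t, HasDerivAt G (deriv G t) t := fun t =>
    (hG.differentiable (by simp) t).hasDerivAt
  have hd1 : ∀ t, HasDerivAt (deriv G) (deriv (deriv G) t) t := fun t =>
    (hG1.differentiable (by simp) t).hasDerivAt
  have hn : ∀ y : E3, HasFDerivAt (fun y : E3 => ‖y‖ ^ 2) (2 • innerSL ℝ y) y := fun y =>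
    (hasStrictFDerivAt_norm_sq y).hasFDerivAt
  have hf : fderiv ℝ (fun y : E3 => G (‖y‖ ^ 2)) =
      fun y => deriv G (‖y‖ ^ 2) • (2 • innerSL ℝ y) := by
    funext y
    exact ((hd0 _).comp_hasFDerivAt y (hn y)).fderiv
  have hff : HasFDerivAt (fun y : E3 => deriv G (‖y‖ ^ 2) • (2 • innerSL ℝ y))
      (deriv G (‖x‖ ^ 2) • (2 • innerSL ℝ : E3 →L[ℝ] E3 →L[ℝ] ℝ) +
        (deriv (deriv G) (‖x‖ ^ 2) • (2 • innerSL ℝ x)).smulRight (2 • innerSL ℝ x)) x :=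
    ((hd1 _).comp_hasFDerivAt x (hn x)).smul
      ((2 • innerSL ℝ : E3 →L[ℝ] E3 →L[ℝ] ℝ).hasFDerivAt)
  rw [congrFun (InnerProductSpace.laplacian_eq_iteratedFDeriv_orthonormalBasis _
    (EuclideanSpace.basisFun (Fin 3) ℝ)) x]
  simp only [iteratedFDeriv_two_apply, hf, hff.fderiv]
  have hx : ‖x‖ ^ 2 = x 0 ^ 2 + x 1 ^ 2 + x 2 ^ 2 := by
    rw [EuclideanSpace.norm_sq_eq, Fin.sum_univ_three]; simp
  have h1 : ∀ i : Fin 3, innerSL ℝ (EuclideanSpace.single i (1 : ℝ))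
      (EuclideanSpace.single i (1 : ℝ)) = (1 : ℝ) := fun i => by
    rw [innerSL_apply_apply, EuclideanSpace.inner_single_right]; simp
  have h2 : ∀ i : Fin 3, inner ℝ x (EuclideanSpace.single i (1 : ℝ)) = x i := fun i => by
    rw [EuclideanSpace.inner_single_right]; simp
  simp [Fin.sum_univ_three, h1, h2]
  rw [hx]
  ring

/-- If `η` is a test function on the half-line, then `η(√t) / √t` extends smoothly to `ℝ`. -/
theorem IsHalfLineTest.contDiff_comp_sqrt_div {η : ℝ → ℝ} (h : IsHalfLineTest η) :
    ContDiff ℝ ∞ (fun t => η (√t) / √t) := by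
  obtain ⟨a, b, ha, hab, h0⟩ := h.exists_support
  refine contDiff_iff_contDiffAt.2 fun t => ?_
  rcases le_or_gt t 0 with ht | ht
  · have : (fun t => η (√t) / √t) =ᶠ[𝓝 t] fun _ => 0 := by
      filter_upwards [Iio_mem_nhds (show t < a ^ 2 by nlinarith)] with s hs
      have : √s < a := by
        rw [Real.sqrt_lt' ha]; exact hs
      rw [h0 _ fun h' => absurd h'.1 (not_le.2 this), zero_div]
    exact contDiffAt_const.congr_of_eventuallyEq this
  · have hs := Real.contDiffAt_sqrt (n := ∞) ht.ne'
    exact (h.contDiff.contDiffAt.comp t hs).div hs (Real.sqrt_pos.2 ht).ne'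

/-- For a half-line test function `η`, the radial function `η(|x|) / |x|` is a test function on `ℝ³`
with Laplacian `η''(|x|) / |x|`. -/
theorem exists_radial_test_function {η : ℝ → ℝ} (h : IsHalfLineTest η) :
    ∃ φ : E3 → ℝ, ContDiff ℝ ∞ φ ∧ HasCompactSupport φ ∧ (∀ x, φ x = η ‖x‖ / ‖x‖) ∧
      ∀ x, x ≠ 0 → (Δ φ) x = deriv (deriv η) ‖x‖ / ‖x‖ := by
  set G : ℝ → ℝ := fun t => η (√t) / √t with hGdef
  have hG : ContDiff ℝ ∞ G := h.contDiff_comp_sqrt_div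
  have hval : ∀ x : E3, G (‖x‖ ^ 2) = η ‖x‖ / ‖x‖ := fun x => by
    simp only [hGdef, Real.sqrt_sq (norm_nonneg x)]
  refine ⟨fun x => G (‖x‖ ^ 2), hG.comp (contDiff_norm_sq ℝ), ?_, hval, fun x hx => ?_⟩
  · obtain ⟨a, b, ha, hab, h0⟩ := h.exists_support
    refine HasCompactSupport.intro (isCompact_closedBall (0 : E3) b) fun x hx => ?_
    rw [hval, h0 _ fun h' => hx (by simpa using h'.2), zero_div]
  · rw [laplacian_comp_norm_sq hG]
    have hr : 0 < ‖x‖ := norm_pos_iff.2 hx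
    have hd0 : ∀ t, HasDerivAt G (deriv G t) t := fun t =>
      (hG.differentiable (by simp) t).hasDerivAt
    have hd1 : ∀ t, HasDerivAt (deriv G) (deriv (deriv G) t) t := fun t =>
      ((contDiff_infty_iff_deriv.1 hG).2.differentiable (by simp) t).hasDerivAt
    have hη : ∀ s, 0 < s → η s = s * G (s ^ 2) := fun s hs => by
      simp only [hGdef, Real.sqrt_sq hs.le]; field_simp
    have hsq : ∀ s : ℝ, HasDerivAt (fun s : ℝ => s ^ 2) (2 * s) s := fun s => by
      simpa using hasDerivAt_pow 2 s
    have hη1 : ∀ s, 0 < s → deriv η s = G (s ^ 2) + 2 * s ^ 2 * deriv G (s ^ 2) := fun s hs => by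
      have e : η =ᶠ[𝓝 s] fun s => s * G (s ^ 2) := by
        filter_upwards [Ioi_mem_nhds hs] with t ht using hη t ht
      rw [e.deriv_eq]
      convert! ((hasDerivAt_id s).mul ((hd0 _).comp s (hsq s))).deriv using 1
      simp; ring
    have hη2 : deriv (deriv η) ‖x‖ =
        6 * ‖x‖ * deriv G (‖x‖ ^ 2) + 4 * ‖x‖ ^ 3 * deriv (deriv G) (‖x‖ ^ 2) := by
      have e : deriv η =ᶠ[𝓝 ‖x‖] fun s => G (s ^ 2) + 2 * s ^ 2 * deriv G (s ^ 2) := by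
        filter_upwards [Ioi_mem_nhds hr] with t ht using hη1 t ht
      rw [e.deriv_eq]
      convert! (((hd0 _).comp ‖x‖ (hsq ‖x‖)).add
        (((hsq ‖x‖).const_mul 2).mul ((hd1 _).comp ‖x‖ (hsq ‖x‖)))).deriv using 1
      simp; ring
    rw [hη2]
    field_simp
    ring

/-! ### Newton's shell theorem -/

open scoped ENNReal

/-- The map `y ↦ (y₀, (y₁, y₂))` preserves volume. -/
theorem measurePreserving_cylinder :
    MeasurePreserving (fun y : E3 => ((y 0, (y 1, y 2)) : ℝ × ℝ × ℝ)) := by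
  have h := (((MeasurePreserving.id (volume : Measure ℝ)).prod
    (volume_preserving_finTwoArrow ℝ)).comp
    (volume_preserving_piFinSuccAbove (fun _ : Fin 3 => ℝ) 0)).comp
    (PiLp.volume_preserving_ofLp (Fin 3))
  exact h

theorem setLIntegral_polarCoord_target {F : ℝ × ℝ → ℝ≥0∞} (hF : Measurable F) :
    ∫⁻ p in polarCoord.target, F p =
      ∫⁻ s in Set.Ioi (0 : ℝ), ∫⁻ θ in Set.Ioo (-π) π, F (s, θ) := by
  rw [polarCoord_target, Measure.volume_eq_prod, ← Measure.prod_restrict,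
    lintegral_prod _ hF.aemeasurable]

/-- Integration in cylindrical coordinates of a function independent of the azimuth. -/
theorem lintegral_cylinder {H : ℝ × ℝ → ℝ≥0∞} (hH : Measurable H) :
    ∫⁻ y : E3, H (y 0, √(y 1 ^ 2 + y 2 ^ 2)) =
      ∫⁻ z, ∫⁻ ρ in Set.Ioi (0 : ℝ), ENNReal.ofReal (2 * π * ρ) * H (z, ρ) := by
  have hm : Measurable fun p : ℝ × ℝ × ℝ => H (p.1, √(p.2.1 ^ 2 + p.2.2 ^ 2)) :=
    hH.comp (by fun_prop)
  have h1 := measurePreserving_cylinder.lintegral_comp hm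
  simp only at h1
  rw [h1, Measure.volume_eq_prod, lintegral_prod _ hm.aemeasurable]
  refine lintegral_congr fun z => ?_
  simp only
  rw [← lintegral_comp_polarCoord_symm, setLIntegral_polarCoord_target]
  · refine setLIntegral_congr_fun measurableSet_Ioi fun ρ hρ => ?_
    have hρ0 : (0 : ℝ) < ρ := hρ
    have e : ∀ θ : ℝ, √((ρ * cos θ) ^ 2 + (ρ * sin θ) ^ 2) = ρ := fun θ => by
      rw [show (ρ * cos θ) ^ 2 + (ρ * sin θ) ^ 2 = ρ ^ 2 * (cos θ ^ 2 + sin θ ^ 2) by ring,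
        cos_sq_add_sin_sq, mul_one, Real.sqrt_sq hρ0.le]
    simp only [polarCoord_symm_apply, e, smul_eq_mul, lintegral_const, Measure.restrict_apply_univ,
      Real.volume_Ioo]
    rw [show π - -π = 2 * π by ring, ENNReal.ofReal_mul (p := 2 * π) (by positivity)]
    ring
  · refine (ENNReal.measurable_ofReal.comp measurable_fst).smul (hH.comp ?_)
    exact measurable_const.prodMk (((continuous_polarCoord_symm.fst.pow 2).add
      (continuous_polarCoord_symm.snd.pow 2)).sqrt.measurable)

/-- The integral over `0 < θ < π` in Newton's theorem: up to normalization, the mean of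
`1 / |x - y|` over the sphere `|y| = s` when `|x| = r`. -/
theorem integral_sin_div_sqrt {r s : ℝ} (hr : 0 < r) (hs : 0 < s) (hrs : s ≠ r) :
    IntervalIntegrable (fun θ => sin θ / √(r ^ 2 + s ^ 2 - 2 * r * s * cos θ)) volume 0 π ∧
    ∫ θ in (0 : ℝ)..π, sin θ / √(r ^ 2 + s ^ 2 - 2 * r * s * cos θ) = 2 / max r s := by
  have hpos : ∀ θ, 0 < r ^ 2 + s ^ 2 - 2 * r * s * cos θ := fun θ => by
    have h1 := cos_le_one θ
    have h2 : 0 < (s - r) ^ 2 := by positivity [sub_ne_zero.2 hrs]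
    nlinarith [mul_pos hr hs]
  have hcont : Continuous fun θ => sin θ / √(r ^ 2 + s ^ 2 - 2 * r * s * cos θ) :=
    continuous_sin.div (by fun_prop) fun θ => (Real.sqrt_pos.2 (hpos θ)).ne'
  refine ⟨hcont.intervalIntegrable _ _, ?_⟩
  have hd : ∀ θ, HasDerivAt (fun θ => √(r ^ 2 + s ^ 2 - 2 * r * s * cos θ) / (r * s))
      (sin θ / √(r ^ 2 + s ^ 2 - 2 * r * s * cos θ)) θ := fun θ => by
    have h1 : HasDerivAt (fun θ => r ^ 2 + s ^ 2 - 2 * r * s * cos θ) (2 * r * s * sin θ) θ := by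
      convert! ((hasDerivAt_cos θ).const_mul (2 * r * s)).const_sub (r ^ 2 + s ^ 2) using 1; ring
    convert! (h1.sqrt (hpos θ).ne').div_const (r * s) using 1
    have := (Real.sqrt_pos.2 (hpos θ)).ne'
    field_simp
  rw [intervalIntegral.integral_eq_sub_of_hasDerivAt (fun θ _ => hd θ)
    (hcont.intervalIntegrable _ _), cos_pi, cos_zero,
    show r ^ 2 + s ^ 2 - 2 * r * s * -1 = (r + s) ^ 2 by ring,
    show r ^ 2 + s ^ 2 - 2 * r * s * 1 = (r - s) ^ 2 by ring, Real.sqrt_sq (by positivity),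
    Real.sqrt_sq_eq_abs]
  rcases le_total r s with h | h
  · rw [max_eq_right h, abs_of_nonpos (by linarith)]; field_simp; ring
  · rw [max_eq_left h, abs_of_nonneg (by linarith)]; field_simp; ring

theorem lintegral_newtonKernel_axis {G : ℝ → ℝ≥0∞} (hG : Measurable G) {r : ℝ} (hr : 0 < r) :
    ∫⁻ y : E3, ENNReal.ofReal (newtonKernel (EuclideanSpace.single 0 r - y)) * G ‖y‖ =
      ∫⁻ s in Set.Ioi (0 : ℝ), ENNReal.ofReal (s ^ 2 / max r s) * G s := by
  set H : ℝ × ℝ → ℝ≥0∞ := fun p =>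
    ENNReal.ofReal (1 / (4 * π * √((r - p.1) ^ 2 + p.2 ^ 2))) * G (√(p.1 ^ 2 + p.2 ^ 2)) with hHdef
  have hH : Measurable H :=
    (ENNReal.measurable_ofReal.comp (by fun_prop)).mul (hG.comp (by fun_prop))
  have e1 : ∀ y : E3, ENNReal.ofReal (newtonKernel (EuclideanSpace.single 0 r - y)) * G ‖y‖ =
      H (y 0, √(y 1 ^ 2 + y 2 ^ 2)) := fun y => by
    have a1 : ‖y‖ = √(y 0 ^ 2 + √(y 1 ^ 2 + y 2 ^ 2) ^ 2) := by
      rw [Real.sq_sqrt (by positivity), EuclideanSpace.norm_eq, Fin.sum_univ_three]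
      simp [add_assoc]
    have a2 : ‖EuclideanSpace.single 0 r - y‖ =
        √((r - y 0) ^ 2 + √(y 1 ^ 2 + y 2 ^ 2) ^ 2) := by
      rw [Real.sq_sqrt (by positivity), EuclideanSpace.norm_eq, Fin.sum_univ_three]
      simp [add_assoc]
    simp only [hHdef, newtonKernel, a2, ← a1]
  rw [lintegral_congr e1, lintegral_cylinder hH]
  -- the half-plane `0 < ρ` in polar coordinates `z = s cos θ`, `ρ = s sin θ`
  set F : ℝ × ℝ → ℝ≥0∞ := fun p =>
    (Set.Ioi (0 : ℝ)).indicator (fun ρ => ENNReal.ofReal (2 * π * ρ) * H (p.1, ρ)) p.2 with hFdef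
  have hF : Measurable F := by
    have : F = (Prod.snd ⁻¹' Set.Ioi (0 : ℝ)).indicator
        (fun p : ℝ × ℝ => ENNReal.ofReal (2 * π * p.2) * H p) := by
      funext p
      simp only [hFdef, Set.indicator, Set.mem_preimage]
    rw [this]
    exact ((ENNReal.measurable_ofReal.comp (by fun_prop)).mul hH).indicator
      (measurable_snd measurableSet_Ioi)
  have e2 : ∫⁻ z, ∫⁻ ρ in Set.Ioi (0 : ℝ), ENNReal.ofReal (2 * π * ρ) * H (z, ρ) =
      ∫⁻ p, F p := by
    rw [Measure.volume_eq_prod, lintegral_prod _ hF.aemeasurable]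
    refine lintegral_congr fun z => ?_
    rw [← lintegral_indicator measurableSet_Ioi]
  rw [e2, ← lintegral_comp_polarCoord_symm, setLIntegral_polarCoord_target
    (F := fun p => ENNReal.ofReal p.1 • F (polarCoord.symm p))
    ((ENNReal.measurable_ofReal.comp measurable_fst).smul
      (hF.comp continuous_polarCoord_symm.measurable))]
  refine setLIntegral_congr_fun_ae measurableSet_Ioi ?_
  filter_upwards [compl_mem_ae_iff.2 (measure_singleton r)] with s hsr hs
  have hs0 : (0 : ℝ) < s := hs
  have hsr' : s ≠ r := hsr
  obtain ⟨hi, hval⟩ := integral_sin_div_sqrt hr hs0 hsr'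
  have e3 : ∀ θ ∈ Set.Ioo (-π) π, ENNReal.ofReal s • F (polarCoord.symm (s, θ)) =
      (Set.Ioc 0 π).indicator (fun θ => ENNReal.ofReal (s ^ 2 / 2) * G s *
        ENNReal.ofReal (sin θ / √(r ^ 2 + s ^ 2 - 2 * r * s * cos θ))) θ := by
    intro θ hθ
    simp only [hFdef, polarCoord_symm_apply, smul_eq_mul]
    by_cases h0 : 0 < θ
    · have hsin : 0 < sin θ := sin_pos_of_pos_of_lt_pi h0 hθ.2
      have hρ : 0 < s * sin θ := mul_pos hs0 hsin
      have b1 : (s * cos θ) ^ 2 + (s * sin θ) ^ 2 = s ^ 2 := by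
        linear_combination s ^ 2 * sin_sq_add_cos_sq θ
      have b2 : (r - s * cos θ) ^ 2 + (s * sin θ) ^ 2 = r ^ 2 + s ^ 2 - 2 * r * s * cos θ := by
        linear_combination s ^ 2 * sin_sq_add_cos_sq θ
      rw [Set.indicator_of_mem (Set.mem_Ioi.2 hρ), Set.indicator_of_mem
        (show θ ∈ Set.Ioc 0 π from ⟨h0, hθ.2.le⟩)]
      simp only [hHdef, b1, b2, Real.sqrt_sq hs0.le]
      rw [← mul_assoc (ENNReal.ofReal s), ← mul_assoc (ENNReal.ofReal s * _),
        ← ENNReal.ofReal_mul hs0.le, mul_right_comm _ (G s), ← ENNReal.ofReal_mul (by positivity),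
        ← ENNReal.ofReal_mul (by positivity)]
      congr 2
      rw [one_div, mul_inv, div_eq_mul_inv]
      field_simp
      ring
    · have hsin : sin θ ≤ 0 := sin_nonpos_of_nonpos_of_neg_pi_le (not_lt.1 h0) hθ.1.le
      rw [Set.indicator_of_notMem, Set.indicator_of_notMem, mul_zero]
      · exact fun h => h0 h.1
      · exact fun h => absurd (Set.mem_Ioi.1 h) (not_lt.2 (mul_nonpos_of_nonneg_of_nonpos hs0.le hsin))
  have hm : Measurable fun θ => sin θ / √(r ^ 2 + s ^ 2 - 2 * r * s * cos θ) := by fun_prop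
  rw [setLIntegral_congr_fun measurableSet_Ioo e3, Measure.restrict_congr_set Ioo_ae_eq_Ioc,
    setLIntegral_indicator measurableSet_Ioc, Set.inter_eq_left.2
      (Set.Ioc_subset_Ioc_left (by linarith [pi_pos])),
    lintegral_const_mul _ hm.ennreal_ofReal,
    ← ofReal_integral_eq_lintegral_ofReal, ← intervalIntegral.integral_of_le pi_pos.le, hval,
    mul_right_comm, ← ENNReal.ofReal_mul (by positivity)]
  · congr 2
    have := lt_max_of_lt_left hr (c := s)
    field_simp
  · exact (intervalIntegrable_iff_integrableOn_Ioc_of_le pi_pos.le).1 hi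
  · refine (ae_restrict_iff' measurableSet_Ioc).2 (ae_of_all _ fun θ hθ => ?_)
    exact div_nonneg (sin_nonneg_of_nonneg_of_le_pi hθ.1.le hθ.2) (Real.sqrt_nonneg _)

/-- Newton's shell theorem: at distance `r` from the center, a shell of radius `s` acts through the
kernel `1 / max r s`. -/
theorem lintegral_newtonKernel {G : ℝ → ℝ≥0∞} (hG : Measurable G) {x : E3} (hx : x ≠ 0) :
    ∫⁻ y : E3, ENNReal.ofReal (newtonKernel (x - y)) * G ‖y‖ =
      ∫⁻ s in Set.Ioi (0 : ℝ), ENNReal.ofReal (s ^ 2 / max ‖x‖ s) * G s := by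
  rw [← lintegral_newtonKernel_axis hG (norm_pos_iff.2 hx)]
  set x₀ : E3 := EuclideanSpace.single 0 ‖x‖
  have hn : ‖x₀‖ = ‖x‖ := by simp [x₀]
  -- the reflection carrying `x₀` to `x` preserves volume
  set T := (ℝ ∙ (x₀ - x))ᗮ.reflection
  have hT : T x₀ = x := Submodule.reflection_sub hn
  rw [← T.measurePreserving.lintegral_comp_emb T.toHomeomorph.measurableEmbedding]
  refine lintegral_congr fun y => ?_
  have h1 : ‖x - T y‖ = ‖x₀ - y‖ := by rw [← hT, ← map_sub, T.norm_map]
  rw [T.norm_map]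
  simp only [newtonKernel, h1]

/-! ### Potential and mass in terms of the radial profile -/

/-- The potential of the radial density `q(|y|)²`, as a function of the radius. -/
noncomputable def shellPotential (q : ℝ → ℝ) (r : ℝ) : ℝ :=
  ∫ s in Set.Ioi (0 : ℝ), s ^ 2 / max r s * q s ^ 2

theorem newtonKernel_nonneg (x : E3) : 0 ≤ newtonKernel x := by
  unfold newtonKernel; positivity

theorem measurable_newtonKernel : Measurable newtonKernel := by
  unfold newtonKernel; fun_prop

section Potential

variable {q : ℝ → ℝ}

theorem lintegral_newtonKernel_mul_sq (hq : Measurable q) {x : E3} (hx : x ≠ 0) :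
    ∫⁻ y : E3, ENNReal.ofReal (newtonKernel (x - y) * q ‖y‖ ^ 2) =
      ∫⁻ s in Set.Ioi (0 : ℝ), ENNReal.ofReal (s ^ 2 / max ‖x‖ s * q s ^ 2) := by
  have h := lintegral_newtonKernel (G := fun s => ENNReal.ofReal (q s ^ 2))
    (hq.pow_const 2).ennreal_ofReal hx
  have h1 : ∀ y : E3, ENNReal.ofReal (newtonKernel (x - y) * q ‖y‖ ^ 2) =
      ENNReal.ofReal (newtonKernel (x - y)) * ENNReal.ofReal (q ‖y‖ ^ 2) := fun y =>
    ENNReal.ofReal_mul (newtonKernel_nonneg _)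
  rw [lintegral_congr h1, h]
  refine lintegral_congr fun s => ?_
  have : 0 ≤ max ‖x‖ s := (norm_nonneg x).trans (le_max_left _ _)
  rw [ENNReal.ofReal_mul (by positivity)]

theorem measurable_shell (hq : Measurable q) (r : ℝ) :
    Measurable fun s => s ^ 2 / max r s * q s ^ 2 := by fun_prop

theorem shell_nonneg {r : ℝ} (hr : 0 ≤ r) (s : ℝ) : 0 ≤ s ^ 2 / max r s * q s ^ 2 := by
  have : 0 ≤ max r s := hr.trans (le_max_left _ _)
  positivity

theorem measurable_newtonKernel_mul_sq (hq : Measurable q) (x : E3) :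
    Measurable fun y : E3 => newtonKernel (x - y) * q ‖y‖ ^ 2 :=
  (measurable_newtonKernel.comp (by fun_prop)).mul ((hq.comp measurable_norm).pow_const 2)

/-- Convergence of the potential at a single point `x ≠ 0` bounds the weighted mass of the profile. -/
theorem integrableOn_shell_of_integrable (hq : Measurable q) {x : E3} (hx : x ≠ 0)
    (h : Integrable fun y : E3 => newtonKernel (x - y) * q ‖y‖ ^ 2) :
    IntegrableOn (fun s => s ^ 2 / max ‖x‖ s * q s ^ 2) (Set.Ioi 0) := by
  rw [← lintegral_ofReal_ne_top_iff_integrable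
    (measurable_newtonKernel_mul_sq hq x).aestronglyMeasurable
    (ae_of_all _ fun y => mul_nonneg (newtonKernel_nonneg _) (sq_nonneg _)),
    lintegral_newtonKernel_mul_sq hq hx] at h
  exact (lintegral_ofReal_ne_top_iff_integrable (measurable_shell hq _).aestronglyMeasurable
    (ae_of_all _ fun s => shell_nonneg (norm_nonneg x) s)).1 h

/-- The identity needs no convergence hypothesis: both integrals are `0` when
the nonnegative integrands have infinite integral. -/
theorem integral_newtonKernel_mul_sq (hq : Measurable q) {x : E3} (hx : x ≠ 0) :
    ∫ y : E3, newtonKernel (x - y) * q ‖y‖ ^ 2 = shellPotential q ‖x‖ := by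
  rw [shellPotential, integral_eq_lintegral_of_nonneg_ae
    (ae_of_all _ fun y => mul_nonneg (newtonKernel_nonneg _) (sq_nonneg _))
    (measurable_newtonKernel_mul_sq hq x).aestronglyMeasurable,
    lintegral_newtonKernel_mul_sq hq hx, integral_eq_lintegral_of_nonneg_ae
    (ae_of_all _ fun s => shell_nonneg (norm_nonneg x) s)
    (measurable_shell hq _).aestronglyMeasurable]

theorem shell_le {r r₀ : ℝ} (hr₀ : 0 < r₀) (hr : r₀ ≤ r) (s : ℝ) :
    s ^ 2 / max r s * q s ^ 2 ≤ s ^ 2 / max r₀ s * q s ^ 2 := by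
  have : 0 < max r₀ s := lt_max_of_lt_left hr₀
  gcongr

theorem tendsto_shellPotential (hq : Measurable q) {r₀ : ℝ} (hr₀ : 0 < r₀)
    (h : IntegrableOn (fun s => s ^ 2 / max r₀ s * q s ^ 2) (Set.Ioi 0)) :
    Tendsto (shellPotential q) atTop (𝓝 0) := by
  have := tendsto_integral_filter_of_dominated_convergence
    (μ := volume.restrict (Set.Ioi (0 : ℝ))) (l := atTop) (f := fun _ => (0 : ℝ))
    (F := fun (r : ℝ) s => s ^ 2 / max r s * q s ^ 2) (fun s => s ^ 2 / max r₀ s * q s ^ 2)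
    (.of_forall fun r => (measurable_shell hq r).aestronglyMeasurable)
    (by
      filter_upwards [eventually_ge_atTop r₀] with r hr
      refine ae_of_all _ fun s => ?_
      rw [Real.norm_of_nonneg (shell_nonneg (hr₀.le.trans hr) s)]
      exact shell_le hr₀ hr s)
    h (ae_of_all _ fun s => by
      have l1 : Tendsto (fun r : ℝ => s ^ 2 / max r s) atTop (𝓝 0) :=
        tendsto_const_nhds.div_atTop
          (tendsto_atTop_mono (fun r => le_max_left r s) tendsto_id)
      simpa using l1.mul_const (q s ^ 2))
  simpa using! this

/-- Outside the mass the potential is that of a point charge, so the error is governed by the mass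
beyond radius `r`. -/
theorem abs_shellPotential_sub_le (hq : Measurable q)
    (h : IntegrableOn (fun s => s ^ 2 * q s ^ 2) (Set.Ioi 0)) {r : ℝ} (hr : 0 < r) :
    |shellPotential q r - (∫ s in Set.Ioi (0 : ℝ), s ^ 2 * q s ^ 2) / r| ≤
      (∫ s in Set.Ioi r, s ^ 2 * q s ^ 2) / r := by
  have hmax : ∀ s, 0 < max r s := fun s => lt_max_of_lt_left hr
  have hle : ∀ s, s ^ 2 / max r s * q s ^ 2 ≤ s ^ 2 * q s ^ 2 / r := fun s => by
    rw [div_mul_eq_mul_div]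
    have := hmax s
    gcongr
    exact le_max_left _ _
  have hi : IntegrableOn (fun s => s ^ 2 / max r s * q s ^ 2) (Set.Ioi 0) := by
    refine Integrable.mono' (h.div_const r) (measurable_shell hq r).aestronglyMeasurable
      (ae_of_all _ fun s => ?_)
    rw [Real.norm_of_nonneg (shell_nonneg hr.le s)]
    exact hle s
  rw [shellPotential, ← integral_div, abs_sub_comm, ← integral_sub (h.div_const r) hi,
    abs_of_nonneg (integral_nonneg fun s => sub_nonneg.2 (hle s)), ← integral_div,
    ← integral_indicator measurableSet_Ioi]
  have h' : IntegrableOn (fun s => s ^ 2 * q s ^ 2 / r) (Set.Ioi r) :=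
    (h.mono_set (Set.Ioi_subset_Ioi hr.le)).div_const r
  rw [← integral_indicator (f := fun s => s ^ 2 * q s ^ 2 / r) measurableSet_Ioi]
  refine integral_mono ((integrable_indicator_iff measurableSet_Ioi).2
    ((h.div_const r).sub hi)) ((integrable_indicator_iff measurableSet_Ioi).2 h') fun s => ?_
  simp only [Set.indicator, Set.mem_Ioi]
  by_cases h1 : r < s
  · rw [if_pos h1, if_pos (hr.trans h1)]
    linarith [shell_nonneg (q := q) hr.le s]
  · rw [if_neg h1]
    split_ifs with h2
    · rw [max_eq_left (not_lt.1 h1), div_mul_eq_mul_div, sub_self]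
    · exact le_rfl

theorem finrank_E3 : Module.finrank ℝ E3 = 3 := by simp

theorem integrable_sq_norm_iff :
    Integrable (fun x : E3 => q ‖x‖ ^ 2) ↔
      IntegrableOn (fun s => s ^ 2 * q s ^ 2) (Set.Ioi 0) := by
  rw [integrable_fun_norm_addHaar (volume : Measure E3) (f := fun s => q s ^ 2), finrank_E3]
  rfl

theorem massConstant_eq {Q : E3 → ℝ} (hQ : ∀ x, Q x = q ‖x‖) :
    massConstant Q = ∫ s in Set.Ioi (0 : ℝ), s ^ 2 * q s ^ 2 := by
  simp only [massConstant, hQ]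
  rw [integral_fun_norm_addHaar (volume : Measure E3) (fun s => q s ^ 2), finrank_E3,
    Measure.real, EuclideanSpace.volume_ball_fin_three, ENNReal.ofReal_one, one_pow, one_mul,
    ENNReal.toReal_ofReal (by positivity)]
  simp only [smul_eq_mul, nsmul_eq_mul, Nat.add_one_sub_one, Nat.cast_ofNat]
  field_simp

end Potential

/-! ### The radial equation -/

theorem LocallyIntegrable.intervalIntegrable_of_comp_norm {F : ℝ → ℝ}
    (h : LocallyIntegrable fun x : E3 => F ‖x‖) {a b : ℝ} (ha : 0 < a) (hab : a ≤ b) :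
    IntervalIntegrable F volume a b := by
  have h1 : IntegrableOn (fun x : E3 => F ‖x‖) (Metric.ball 0 (b + 1)) :=
    (h.integrableOn_isCompact (isCompact_closedBall 0 (b + 1))).mono_set Metric.ball_subset_closedBall
  rw [integrableOn_fun_norm_addHaar, finrank_E3] at h1
  rw [intervalIntegrable_iff_integrableOn_Icc_of_le hab]
  have hsub : Set.Icc a b ⊆ Set.Ioo 0 (b + 1) := fun x hx =>
    ⟨ha.trans_le hx.1, by linarith [hx.2]⟩
  refine ((h1.mono_set hsub).continuousOn_mul (g := fun y : ℝ => (y ^ 2)⁻¹)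
    (ContinuousOn.inv₀ (by fun_prop) fun y hy => pow_ne_zero 2 (ha.trans_le hy.1).ne')
    isCompact_Icc).congr_fun (fun y hy => ?_) measurableSet_Icc
  have := (ha.trans_le hy.1).ne'
  simp only [smul_eq_mul, Nat.add_one_sub_one]
  field_simp

/-- Two radial functions on `ℝ³` have equal integrals iff their profiles weighted by `r²` do. -/
theorem integral_Ioi_eq_of_integral_norm_eq {Φ Ψ : ℝ → ℝ}
    (h : ∫ x : E3, Φ ‖x‖ = ∫ x : E3, Ψ ‖x‖) :
    ∫ r in Set.Ioi (0 : ℝ), r ^ 2 * Φ r = ∫ r in Set.Ioi (0 : ℝ), r ^ 2 * Ψ r := by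
  rw [integral_fun_norm_addHaar (volume : Measure E3), integral_fun_norm_addHaar, finrank_E3,
    nsmul_right_inj (by norm_num)] at h
  have hv : (volume : Measure E3).real (Metric.ball 0 1) ≠ 0 :=
    (ENNReal.toReal_pos (Metric.measure_ball_pos volume 0 one_pos).ne'
      measure_ball_lt_top.ne).ne'
  exact mul_left_cancel₀ hv h

/-- The radial reduction: for a radial distributional solution `Q(x) = q(|x|)`, the function
`u(r) = r q(r)` solves `u'' = (1 - ε W - f(q)) u`, with `W` the potential of `Q²`. -/
theorem IsSolution.exists_isCaratheodorySol {ε : ℝ} {f : ℝ → ℝ} {Q : E3 → ℝ} {q : ℝ → ℝ}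
    (h : IsSolution ε f Q) (hQ : ∀ x, Q x = q ‖x‖) (hq : Measurable q)
    (hqc : ContinuousOn q (Set.Ioi 0)) :
    ∃ p, IsCaratheodorySol (fun r => 1 - ε * shellPotential q r - f (q r)) (fun r => r * q r) p := by
  have hne : ∀ᵐ x : E3, x ≠ 0 := compl_mem_ae_iff.2 (measure_singleton 0)
  have hV : ∀ x : E3, x ≠ 0 → newtonPotential Q x = shellPotential q ‖x‖ := fun x hx => by
    rw [← integral_newtonKernel_mul_sq hq hx, newtonPotential]
    simp only [hQ]
  -- for all radii at once, without continuity of the potential: local integrability of the nonlocal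
  -- term is part of `IsSolution`
  have i1 : ∀ a b, 0 < a → a ≤ b →
      IntervalIntegrable (fun r => shellPotential q r * q r) volume a b := fun a b ha hab => by
    refine LocallyIntegrable.intervalIntegrable_of_comp_norm
      (h.nonlocal_locallyIntegrable.congr ?_) ha hab
    filter_upwards [hne] with x hx
    rw [hV x hx, hQ]
  have i2 : ∀ a b, 0 < a → a ≤ b → IntervalIntegrable (fun r => f (q r) * q r) volume a b :=
    fun a b ha hab => LocallyIntegrable.intervalIntegrable_of_comp_norm (by
      simpa only [hQ] using h.local_locallyIntegrable) ha hab
  have hu : ContinuousOn (fun r => r * q r) (Set.Ioi 0) := continuousOn_id.mul hqc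
  have iu := hu.intervalIntegrable_of_pos
  have iF : ∀ a b, 0 < a → a ≤ b → IntervalIntegrable
      (fun r => (ε * shellPotential q r + f (q r)) * (r * q r)) volume a b := fun a b ha hab => by
    have := (((i1 a b ha hab).const_mul ε).add (i2 a b ha hab)).continuousOn_mul
      (g := fun r => r) continuousOn_id
    refine this.congr fun r _ => ?_
    ring
  have hk : ∀ a b, 0 < a → a ≤ b → IntervalIntegrable
      (fun r => (1 - ε * shellPotential q r - f (q r)) * (r * q r)) volume a b :=
    fun a b ha hab => ((iu a b ha hab).sub (iF a b ha hab)).congr fun r _ => by ring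
  obtain ⟨p, hp1, hp2⟩ := exists_hasDerivAt_of_integral_mul_deriv_deriv_eq hu hk fun η hη => by
    obtain ⟨φ, hφ, hφc, hφv, hφL⟩ := exists_radial_test_function hη
    have e := h.equation φ hφ hφc
    have e1 : ∫ x, Q x * (-(Δ φ) x + φ x) =
        ∫ x : E3, (fun r => q r * (-(deriv (deriv η) r / r) + η r / r)) ‖x‖ := by
      refine integral_congr_ae ?_
      filter_upwards [hne] with x hx
      rw [hQ, hφL x hx, hφv]
    have e2 : ∫ x, (ε * newtonPotential Q x * Q x + f (Q x) * Q x) * φ x =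
        ∫ x : E3, (fun r => (ε * shellPotential q r * q r + f (q r) * q r) * (η r / r)) ‖x‖ := by
      refine integral_congr_ae ?_
      filter_upwards [hne] with x hx
      rw [hV x hx, hQ, hφv]
    rw [e1, e2] at e
    have e3 := integral_Ioi_eq_of_integral_norm_eq
      (Φ := fun r => q r * (-(deriv (deriv η) r / r) + η r / r))
      (Ψ := fun r => (ε * shellPotential q r * q r + f (q r) * q r) * (η r / r)) e
    have hext : ∀ {F ζ : ℝ → ℝ}, IsHalfLineTest ζ →
        ∫ r in Set.Ioi (0 : ℝ), F r * ζ r = ∫ r, F r * ζ r := fun {F ζ} hζ => by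
      obtain ⟨a, b, ha, hab, h0⟩ := hζ.exists_support
      refine setIntegral_eq_integral_of_forall_compl_eq_zero fun r hr => ?_
      rw [h0 r fun hr' => hr (ha.trans_le hr'.1), mul_zero]
    have e4 : ∫ r in Set.Ioi (0 : ℝ), r ^ 2 * (q r * (-(deriv (deriv η) r / r) + η r / r)) =
        ∫ r in Set.Ioi (0 : ℝ), (r * q r) * (η r - deriv (deriv η) r) :=
      setIntegral_congr_fun measurableSet_Ioi fun r hr => by
        have : r ≠ 0 := ne_of_gt hr
        field_simp
        ring
    have e5 : ∫ r in Set.Ioi (0 : ℝ),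
        r ^ 2 * ((ε * shellPotential q r * q r + f (q r) * q r) * (η r / r)) =
        ∫ r in Set.Ioi (0 : ℝ), ((ε * shellPotential q r + f (q r)) * (r * q r)) * η r :=
      setIntegral_congr_fun measurableSet_Ioi fun r hr => by
        have : r ≠ 0 := ne_of_gt hr
        field_simp
    rw [e4, e5, hext (hη.sub hη.deriv.deriv), hext hη] at e3
    have e6 : (fun r => (r * q r) * (η r - deriv (deriv η) r)) =
        fun r => (r * q r) * η r - (r * q r) * deriv (deriv η) r := by funext r; ring
    rw [e6, integral_sub (hη.integrable_mul iu) (hη.deriv.deriv.integrable_mul iu)] at e3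
    have e7 : (fun r => (1 - ε * shellPotential q r - f (q r)) * (r * q r) * η r) =
        fun r => (r * q r) * η r - ((ε * shellPotential q r + f (q r)) * (r * q r)) * η r := by
      funext r; ring
    rw [e7, integral_sub (hη.integrable_mul iu) (hη.integrable_mul iF)]
    linarith
  exact ⟨p, hp1, hk, hp2⟩

/-! ### Decay and asymptotics of the profile -/

theorem eventually_abs_le_rpow {f : ℝ → ℝ} {β : ℝ}
    (hf : Tendsto (fun t : ℝ => f t / t ^ β) (𝓝[>] 0) (𝓝 0)) :
    ∀ᶠ t in 𝓝[>] (0 : ℝ), |f t| ≤ t ^ β := by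
  filter_upwards [hf.abs.eventually_lt_const (u := 1) (by simp), self_mem_nhdsWithin]
    with t ht ht0
  have h0 : 0 < t ^ β := rpow_pos_of_pos ht0 β
  rw [abs_div, abs_of_pos h0, div_lt_one h0] at ht
  exact ht.le

/-- Exponential decay of the profile makes the mass finite and the tail of the mass `O(1/r)`. -/
theorem integral_tail_le_of_exp_decay {q : ℝ → ℝ} {R C : ℝ} (hR : 0 < R)
    (hq : Measurable q) (hpos : ∀ r, 0 < q r) (hC : ∀ r, R ≤ r → r * q r ≤ C * exp (-r / 2)) :
    IntegrableOn (fun s => s ^ 2 * q s ^ 2) (Set.Ioi R) ∧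
      ∀ r, R ≤ r → ∫ s in Set.Ioi r, s ^ 2 * q s ^ 2 ≤ C ^ 2 / r := by
  have hle : ∀ s, R < s → s ^ 2 * q s ^ 2 ≤ C ^ 2 * exp (-s) := fun s hs => by
    have h0 : 0 < s * q s := mul_pos (hR.trans hs) (hpos s)
    calc s ^ 2 * q s ^ 2 = (s * q s) ^ 2 := by ring
      _ ≤ (C * exp (-s / 2)) ^ 2 := by
        have := hC s hs.le
        gcongr
      _ = C ^ 2 * exp (-s) := by
        rw [mul_pow, ← exp_nat_mul]; congr 2; push_cast; ring
  have hint : IntegrableOn (fun s => C ^ 2 * exp (-s)) (Set.Ioi R) :=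
    (integrableOn_exp_neg_Ioi R).const_mul _
  have hmain : IntegrableOn (fun s => s ^ 2 * q s ^ 2) (Set.Ioi R) := by
    refine Integrable.mono' hint (by fun_prop)
      ((ae_restrict_iff' measurableSet_Ioi).2 (ae_of_all _ fun s hs => ?_))
    rw [Real.norm_of_nonneg (by positivity)]
    exact hle s hs
  refine ⟨hmain, fun r hr => ?_⟩
  have hr0 : 0 < r := hR.trans_le hr
  have hsub := Set.Ioi_subset_Ioi hr
  calc ∫ s in Set.Ioi r, s ^ 2 * q s ^ 2 ≤ ∫ s in Set.Ioi r, C ^ 2 * exp (-s) :=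
        setIntegral_mono_on (hmain.mono_set hsub) (hint.mono_set hsub) measurableSet_Ioi
          fun s hs => hle s (hr.trans_lt hs)
    _ = C ^ 2 * exp (-r) := by rw [integral_const_mul, integral_exp_neg_Ioi]
    _ ≤ C ^ 2 / r := by
        rw [exp_neg, ← div_eq_mul_inv]
        have := add_one_le_exp r
        gcongr
        linarith

/-- An exponentially decaying quantity `(C exp (-r/2)) ^ β` is `O(r⁻²)`. -/
theorem rpow_exp_neg_le {β C : ℝ} (hβ : 0 < β) (hC : 0 < C) {r : ℝ} (hr : 0 < r) :
    (C * exp (-r / 2)) ^ β ≤ 8 * C ^ β / β ^ 2 / r ^ 2 := by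
  rw [mul_rpow hC.le (exp_pos _).le, ← exp_mul, show -r / 2 * β = -(β * r / 2) by ring, exp_neg]
  have h1 := quadratic_le_exp_of_nonneg (x := β * r / 2) (by positivity)
  have h2 : (β * r) ^ 2 / 8 ≤ exp (β * r / 2) := by
    have : 0 < β * r := mul_pos hβ hr
    nlinarith
  calc C ^ β * (exp (β * r / 2))⁻¹ ≤ C ^ β * ((β * r) ^ 2 / 8)⁻¹ := by gcongr
    _ = _ := by field_simp

/-- The radial form of the result: `q` is the profile of the solution and `r q(r)` solves the
radial equation. -/
theorem exists_tendsto_of_isCaratheodorySol {ε : ℝ} (hε : |ε| = 1) {f q p : ℝ → ℝ} {β : ℝ}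
    (hβ : 0 < β) (hf : Tendsto (fun t : ℝ => f t / t ^ β) (𝓝[>] 0) (𝓝 0)) (hq : Measurable q)
    (hpos : ∀ r, 0 < q r) (hlim : Tendsto q atTop (𝓝 0)) {r₀ : ℝ} (hr₀ : 0 < r₀)
    (hint : IntegrableOn (fun s => s ^ 2 / max r₀ s * q s ^ 2) (Set.Ioi 0))
    (hsol : IsCaratheodorySol (fun r => 1 - ε * shellPotential q r - f (q r))
      (fun r => r * q r) p) :
    IntegrableOn (fun s => s ^ 2 * q s ^ 2) (Set.Ioi 0) ∧ ∃ l, 0 < l ∧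
      Tendsto (fun r => r * q r *
        r ^ (-(ε * (∫ s in Set.Ioi (0 : ℝ), s ^ 2 * q s ^ 2) / 2)) * exp r) atTop (𝓝 l) := by
  have hupos : ∀ r, 0 < r → 0 < r * q r := fun r hr => mul_pos hr (hpos r)
  have hlim' : Tendsto q atTop (𝓝[>] 0) :=
    tendsto_nhdsWithin_iff.2 ⟨hlim, .of_forall hpos⟩
  have hfq := hlim'.eventually (eventually_abs_le_rpow hf)
  have hqβ : Tendsto (fun r => q r ^ β) atTop (𝓝 0) := by
    have := hlim.rpow_const (p := β) (Or.inr hβ.le)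
    rwa [zero_rpow hβ.ne'] at this
  have hW := (tendsto_shellPotential hq hr₀ hint).abs.eventually_lt_const
    (u := 1 / 4) (by norm_num)
  obtain ⟨R, hR⟩ := eventually_atTop.1 (((hfq.and
    (hqβ.eventually_lt_const (u := 1 / 4) (by norm_num))).and hW).and (eventually_ge_atTop 1))
  have hR0 : 0 < R := by linarith [(hR R le_rfl).2]
  have hg : ∀ r, R ≤ r → 1 / 4 ≤ 1 - ε * shellPotential q r - f (q r) := fun r hr => by
    obtain ⟨⟨⟨h1, h2⟩, h3⟩, -⟩ := hR r hr
    have h4 : |ε * shellPotential q r| ≤ 1 / 4 := by rw [abs_mul, hε, one_mul]; exact h3.le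
    linarith [(abs_le.1 h4).2, (abs_le.1 (h1.trans h2.le)).2]
  have hg0 : ∀ r, R ≤ r → 0 ≤ 1 - ε * shellPotential q r - f (q r) := fun r hr =>
    le_trans (by norm_num) (hg r hr)
  have hsub : Tendsto (fun r => r * q r / r) atTop (𝓝 0) := by
    refine hlim.congr' ?_
    filter_upwards [eventually_gt_atTop 0] with r hr
    field_simp
  obtain ⟨C, hC0, hC⟩ := hsol.exp_decay hupos hR0 hg hsub
  obtain ⟨hi1, htail⟩ := integral_tail_le_of_exp_decay hR0 hq hpos hC
  have hmass : IntegrableOn (fun s => s ^ 2 * q s ^ 2) (Set.Ioi 0) := by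
    rw [← Set.Ioc_union_Ioi_eq_Ioi hR0.le]
    refine IntegrableOn.union ?_ hi1
    refine Integrable.mono' ((hint.mono_set Set.Ioc_subset_Ioi_self).const_mul (max r₀ R))
      (by fun_prop) ((ae_restrict_iff' measurableSet_Ioc).2 (ae_of_all _ fun s hs => ?_))
    have h1 : 0 < max r₀ s := lt_max_of_lt_left hr₀
    rw [Real.norm_of_nonneg (by positivity)]
    calc s ^ 2 * q s ^ 2 = max r₀ s * (s ^ 2 / max r₀ s * q s ^ 2) := by field_simp
      _ ≤ max r₀ R * (s ^ 2 / max r₀ s * q s ^ 2) := by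
        have := hs.2
        gcongr
  refine ⟨hmass, ?_⟩
  set α := ∫ s in Set.Ioi (0 : ℝ), s ^ 2 * q s ^ 2 with hα
  refine hsol.exists_tendsto (C := C ^ 2 + 8 * C ^ β / β ^ 2) hupos hR0 hg0
    (fun r hr => hsol.deriv_nonpos hupos hR0 hg0 hsub hr) fun r hr => ?_
  obtain ⟨⟨⟨h1, -⟩, -⟩, h5⟩ := hR r hr
  have hr0 : 0 < r := hR0.trans_le hr
  have e1 : |shellPotential q r - α / r| ≤ C ^ 2 / r ^ 2 := by
    refine (abs_shellPotential_sub_le hq hmass hr0).trans ?_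
    rw [pow_two r, ← div_div]
    have := htail r hr
    gcongr
  have e2 : |f (q r)| ≤ 8 * C ^ β / β ^ 2 / r ^ 2 := by
    refine h1.trans (le_trans ?_ (rpow_exp_neg_le hβ hC0 hr0))
    have h6 : q r ≤ r * q r := le_mul_of_one_le_left (hpos r).le h5
    exact rpow_le_rpow (hpos r).le (h6.trans (hC r hr)) hβ.le
  calc _ = |-(ε * (shellPotential q r - α / r)) - f (q r)| := by congr 1; ring
    _ ≤ |-(ε * (shellPotential q r - α / r))| + |f (q r)| := abs_sub _ _
    _ ≤ C ^ 2 / r ^ 2 + 8 * C ^ β / β ^ 2 / r ^ 2 := by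
        rw [abs_neg, abs_mul, hε, one_mul]
        exact add_le_add e1 e2
    _ = _ := by ring

theorem theorem4p1 (ε : ℝ) (hε : ε = 1 ∨ ε = -1) (f : ℝ → ℝ) (β : ℝ) (hβ : 0 < β)
    (hf : Tendsto (fun t : ℝ => f t / t ^ β) (𝓝[>] 0) (𝓝 0))
    (Q : E3 → ℝ) (hpos : ∀ x, 0 < Q x) (hrad : IsRadial Q)
    (hcont : ContinuousOn Q {0}ᶜ)
    (hsol : IsSolution ε f Q) (hdecay : Tendsto Q (cocompact E3) (𝓝 0)) :
    Integrable (fun x => Q x ^ 2) ∧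
      ∃ l : ℝ, 0 < l ∧
        Tendsto (fun x : E3 => Q x * ‖x‖ ^ (1 - ε * massConstant Q / 2) * Real.exp ‖x‖)
          (cocompact E3) (𝓝 l) := by
  -- the profile along a half-axis
  set q : ℝ → ℝ := fun r => Q (EuclideanSpace.single 0 r) with hqdef
  have hQ : ∀ x, Q x = q ‖x‖ := fun x => hrad _ _ (by simp)
  have hsingle : Continuous fun r : ℝ => (EuclideanSpace.single 0 r : E3) :=
    (PiLp.continuous_toLp 2 fun _ : Fin 3 => ℝ).comp
      (continuous_pi fun i => by
        by_cases h : i = 0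
        · subst h; simpa using continuous_id'
        · simpa [Pi.single_apply, h] using continuous_const)
  have hqc0 : ContinuousOn q {0}ᶜ := hcont.comp hsingle.continuousOn fun r hr => by
    simpa using hr
  have hq : Measurable q := measurable_of_continuousOn_compl_singleton 0 hqc0
  have hqc : ContinuousOn q (Set.Ioi 0) := hqc0.mono fun r hr => ne_of_gt hr
  have hlim : Tendsto q atTop (𝓝 0) := by
    refine hdecay.comp ?_
    rw [← Metric.cobounded_eq_cocompact, ← tendsto_norm_atTop_iff_cobounded]
    simpa using tendsto_abs_atTop_atTop
  have hne : ∀ᵐ x : E3, x ≠ 0 := compl_mem_ae_iff.2 (measure_singleton 0)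
  obtain ⟨x₀, hx₀, hx₀i⟩ := (hne.and hsol.convolution_converges).exists
  have hint := integrableOn_shell_of_integrable hq hx₀ (by simpa only [hQ] using hx₀i)
  obtain ⟨p, hp⟩ := hsol.exists_isCaratheodorySol hQ hq hqc
  obtain ⟨hmass, l, hl, ht⟩ := exists_tendsto_of_isCaratheodorySol
    (by rcases hε with rfl | rfl <;> simp) hβ hf hq (fun r => hpos _) hlim
    (norm_pos_iff.2 hx₀) hint hp
  refine ⟨?_, l, hl, ?_⟩
  · simpa only [hQ] using integrable_sq_norm_iff.2 hmass
  · rw [massConstant_eq hQ]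
    refine (ht.comp (tendsto_norm_cocompact_atTop (E := E3))).congr' ?_
    have hev : ∀ᶠ x : E3 in cocompact E3, 0 < ‖x‖ :=
      (tendsto_norm_cocompact_atTop (E := E3)).eventually_gt_atTop 0
    filter_upwards [hev] with x hx
    rw [Function.comp_apply, hQ x, sub_eq_add_neg 1, rpow_add hx, rpow_one]
    ring
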